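/- Let $G$ be an infinite countable abelian group, $H_{\mathbf R}$ a real Hilbert space and $\pi : G \to \mathcal O(H_{\mathbf R})$ an orthogonal representation which is mixing, that is, $\langle \pi(g)\xi, \eta\rangle \to 0$ as $g \to \infty$ in $G$ for all $\xi, \eta \in H_{\mathbf R}$. Let $H = H_{\mathbf R} \oplus \mathrm i H_{\mathbf R}$ be the complexification of $H_{\mathbf R}$, $\mathcal F(H) = \mathbf C\Omega \oplus \bigoplus_{n \ge 1} H^{\otimes n}$ its full Fock space with vacuum vector $\Omega$, $\ell(e)$ the left creation operator of $e \in H$, and $\Gamma(H_{\mathbf R})''$ the von Neumann algebra on $\mathcal F(H)$ generated by the operators $\ell(e) + \ell(e)^*$, $e \in H_{\mathbf R}$. The free Bogoljubov action of $G$ on $\Gamma(H_{\mathbf R})''$ is $\sigma^\pi_g = \mathrm{Ad}(\mathcal F(\pi(g)))$, where $\mathcal F(\pi(g)) = \mathrm{id}_{\mathbf C\Omega} \oplus \bigoplus_{n\ge1} \pi(g)^{\otimes n}$. Let $M = \Gamma(H_{\mathbf R})'' \rtimes_\pi G$ be the crossed product by this action, realized as the von Neumann algebra on $\mathcal F(H)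 \otimes \ell^2(G)$ generated by $\{a \otimes 1 : a \in \Gamma(H_{\mathbf R})''\}$ and the unitaries $u_g = \mathcal F(\pi(g)) \otimes \lambda_g$, $g \in G$, where $\lambda$ is the left regular representation of $G$. Let $\mathrm L(G) \subset M$ be the von Neumann subalgebra generated by $\{u_g : g \in G\}$, and let $\tau = \langle\, \cdot\, (\Omega \otimes \delta_1), \Omega \otimes \delta_1\rangle$. Then $\tau$ is a faithful normal tracial state on $M$, and $\mathrm L(G) \subset M$ has Popa's asymptotic orthogonality property: there is a free ultrafilter $\omega$ on $\mathbf N$ such that for all $x, y \in (M^\omega \ominus \mathrm L(G)^\omega) \cap \mathrm L(G)'$ and all $a, b \in M \ominus \mathrm L(G)$, the vectors $ax$ and $yb$ are orthogonal in $\mathrm L^2(M^\omega, \tau_\omega)$. Here $M^\omega$ is the tracial ultraproduct, the quotient of the $*$-algebra of norm bounded sequences in $M$ by the ideal of the sequences $(x_n)$ with $\lim_{n\to\omega} \|x_n\|_2 = 0$, where $\|x\|_2 = \tau(x^*x)^{1/2}$; its trace is $\tau_\omega((x_n)) = \lim_{n \to \omega} \tau(x_n)$; $M$ is embedded in $M^\omega$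 by constant sequences; $\mathrm L(G)^\omega \subset M^\omega$ consists of the classes of bounded sequences in $\mathrm L(G)$; and $\ominus$ denotes the orthogonal complement for the inner product given by the trace. -/

import Mathlib

noncomputable section

namespace FreeBogoljubov

open scoped ComplexOrder InnerProductSpace

/-! ### Complexification of a real Hilbert space -/

/-- The complexification `H ⊕ i H` of a real Hilbert space `H`; the pair `⟨a, b⟩` is the vector
`a + i b`. -/
@[ext]
structure Complexification (H : Type*) where
  /-- the real part -/
  re : H
  /-- the imaginary part -/
  im : H

namespace Complexification

variable {H : Type*} [NormedAddCommGroup H]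

instance : Zero (Complexification H) := ⟨⟨0, 0⟩⟩
instance : Add (Complexification H) := ⟨fun x y => ⟨x.re + y.re, x.im + y.im⟩⟩
instance : Neg (Complexification H) := ⟨fun x => ⟨-x.re, -x.im⟩⟩
@[simp] theorem zero_re : (0 : Complexification H).re = 0 := rfl
@[simp] theorem zero_im : (0 : Complexification H).im = 0 := rfl
@[simp] theorem add_re (x y : Complexification H) : (x + y).re = x.re + y.re := rfl
@[simp] theorem add_im (x y : Complexification H) : (x + y).im = x.im + y.im := rfl
@[simp] theorem neg_re (x : Complexification H) : (-x).re = -x.re := rfl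
@[simp] theorem neg_im (x : Complexification H) : (-x).im = -x.im := rfl

variable [InnerProductSpace ℝ H]

instance : SMul ℂ (Complexification H) :=
  ⟨fun c x => ⟨c.re • x.re - c.im • x.im, c.re • x.im + c.im • x.re⟩⟩

@[simp] theorem smul_re (c : ℂ) (x : Complexification H) :
    (c • x).re = c.re • x.re - c.im • x.im := rfl
@[simp] theorem smul_im (c : ℂ) (x : Complexification H) :
    (c • x).im = c.re • x.im + c.im • x.re := rfl

instance : AddCommGroup (Complexification H) where
  add_assoc x y z := by ext <;> simp [add_assoc]
  zero_add x := by ext <;> simp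
  add_zero x := by ext <;> simp
  add_comm x y := by ext <;> simp [add_comm]
  neg_add_cancel x := by ext <;> simp
  nsmul := nsmulRec
  zsmul := zsmulRec

instance : Module ℂ (Complexification H) where
  one_smul x := by ext <;> simp
  mul_smul c d x := by ext <;> simp <;> module
  smul_zero c := by ext <;> simp
  smul_add c x y := by ext <;> simp <;> module
  add_smul c d x := by ext <;> simp <;> module
  zero_smul x := by ext <;> simp

/-- `⟪a + i b, c + i d⟫ = ⟪a, c⟫ + ⟪b, d⟫ + i (⟪a, d⟫ - ⟪b, c⟫)`, conjugate linear in the first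
variable. -/
instance core : InnerProductSpace.Core ℂ (Complexification H) where
  inner x y := ⟨⟪x.re, y.re⟫_ℝ + ⟪x.im, y.im⟫_ℝ, ⟪x.re, y.im⟫_ℝ - ⟪x.im, y.re⟫_ℝ⟩
  conj_inner_symm x y := by
    apply Complex.ext <;> simp [real_inner_comm]
  re_inner_nonneg x := by
    simpa using add_nonneg (real_inner_self_nonneg (x := x.re)) (real_inner_self_nonneg (x := x.im))
  add_left x y z := by
    apply Complex.ext <;> simp [inner_add_left] <;> ring
  smul_left x y c := by
    apply Complex.ext <;>
      simp [inner_add_left, inner_sub_left, real_inner_smul_left] <;> ring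
  definite x hx := by
    have h := congrArg Complex.re hx
    simp only [Complex.zero_re] at h
    have h1 := real_inner_self_nonneg (x := x.re)
    have h2 := real_inner_self_nonneg (x := x.im)
    ext
    · exact inner_self_eq_zero.1 (show ⟪x.re, x.re⟫_ℝ = 0 by linarith)
    · exact inner_self_eq_zero.1 (show ⟪x.im, x.im⟫_ℝ = 0 by linarith)

instance : NormedAddCommGroup (Complexification H) :=
  InnerProductSpace.Core.toNormedAddCommGroup (𝕜 := ℂ)

instance : InnerProductSpace ℂ (Complexification H) := InnerProductSpace.ofCore core.toCore

theorem inner_def (x y : Complexification H) :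
    ⟪x, y⟫_ℂ = ⟨⟪x.re, y.re⟫_ℝ + ⟪x.im, y.im⟫_ℝ, ⟪x.re, y.im⟫_ℝ - ⟪x.im, y.re⟫_ℝ⟩ := rfl

/-- The inclusion of `H` in its complexification. -/
def ofReal (e : H) : Complexification H := ⟨e, 0⟩

/-- The complexification of an orthogonal transformation, a unitary operator. -/
def map (U : H ≃ₗᵢ[ℝ] H) : Complexification H →ₗᵢ[ℂ] Complexification H :=
  LinearMap.isometryOfInner
    { toFun := fun x => ⟨U x.re, U x.im⟩
      map_add' := fun x y => by ext <;> simp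
      map_smul' := fun c x => by ext <;> simp }
    fun x y => by simp [inner_def]

end Complexification

/-! ### The full Fock space -/

section Fock

variable {E : Type*} [NormedAddCommGroup E] [InnerProductSpace ℂ E]

/-- The inner product of two elementary tensors `e₁ ⊗ ⋯ ⊗ e_m` and `f₁ ⊗ ⋯ ⊗ f_n`, written as
lists (the empty list is the vacuum vector): `∏ ⟪e_i, f_i⟫` if `m = n`, and `0` otherwise. -/
def wordInner : List E → List E → ℂ
  | [], [] => 1
  | e :: v, f :: w => ⟪e, f⟫_ℂ * wordInner v w
  | [], _ :: _ => 0
  | _ :: _, [] => 0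

theorem wordInner_conj (v w : List E) : star (wordInner v w) = wordInner w v := by
  induction v generalizing w with
  | nil => cases w <;> simp [wordInner]
  | cons e v ih =>
    cases w with
    | nil => simp [wordInner]
    | cons f w =>
      simp only [wordInner, star_mul', ih w]
      rw [← inner_conj_symm f e]
      rfl

theorem gram_posSemidef {ι F : Type*} [NormedAddCommGroup F] [InnerProductSpace ℂ F] (u : ι → F) :
    (Matrix.of fun i j => ⟪u i, u j⟫_ℂ).PosSemidef := by
  refine ⟨?_, fun x => ?_⟩
  · ext i j
    simp
  · have h : (x.sum fun i xi => x.sum fun j xj => star xi * ⟪u i, u j⟫_ℂ * xj) =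
        ⟪x.sum fun i a => a • u i, x.sum fun i a => a • u i⟫_ℂ := by
      rw [Finsupp.sum_inner]
      refine Finset.sum_congr rfl fun i _ => ?_
      dsimp only
      rw [Finsupp.inner_sum]
      refine Finset.sum_congr rfl fun j _ => ?_
      simp only [inner_smul_left, inner_smul_right, RCLike.star_def]
      ring
    simp only [Matrix.of_apply]
    rw [h, inner_self_eq_norm_sq_to_K]
    simp

/-- The matrix of inner products of elementary tensors of length at most `n` is positive. -/
theorem wordInner_posSemidef_of_length (n : ℕ) :
    (Matrix.of fun v w : {v : List E // v.length ≤ n} => wordInner v.1 w.1).PosSemidef := by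
  classical
  have hnil : ∀ m : ℕ, (Matrix.of fun v w : {v : List E // v.length ≤ m} =>
      ⟪(if v.1 = [] then (1 : ℂ) else 0), (if w.1 = [] then (1 : ℂ) else 0)⟫_ℂ).PosSemidef :=
    fun m => gram_posSemidef _
  induction n with
  | zero =>
    convert hnil 0 using 1
    ext ⟨v, hv⟩ ⟨w, hw⟩
    obtain rfl := List.length_eq_zero_iff.1 (Nat.le_zero.1 hv)
    obtain rfl := List.length_eq_zero_iff.1 (Nat.le_zero.1 hw)
    simp [wordInner]
  | succ n ih =>
    have htail := ih.submatrix (fun v : {v : List E // v.length ≤ n + 1} =>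
      (⟨v.1.tail, by have := v.2; simp; omega⟩ : {v : List E // v.length ≤ n}))
    have hhead := gram_posSemidef
      (fun v : {v : List E // v.length ≤ n + 1} => v.1.headD 0)
    convert (hnil (n + 1)).add (hhead.hadamard htail) using 1
    ext ⟨v, hv⟩ ⟨w, hw⟩
    cases v <;> cases w <;> simp [wordInner, Matrix.hadamard]

/-- The sesquilinear extension of `wordInner` to formal linear combinations of elementary
tensors. -/
def wordForm (x y : List E →₀ ℂ) : ℂ :=
  x.sum fun v a => y.sum fun w b => star a * wordInner v w * b

theorem wordForm_conj (x y : List E →₀ ℂ) : star (wordForm x y) = wordForm y x := by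
  simp only [wordForm, Finsupp.sum, star_sum, star_mul']
  rw [Finset.sum_comm]
  refine Finset.sum_congr rfl fun v _ => Finset.sum_congr rfl fun w _ => ?_
  rw [wordInner_conj, star_star]
  ring

theorem wordForm_add_left (x y z : List E →₀ ℂ) :
    wordForm (x + y) z = wordForm x z + wordForm y z := by
  refine Finsupp.sum_add_index' (fun v => ?_) (fun v a b => ?_)
  · simp
  · rw [← Finsupp.sum_add]
    refine Finset.sum_congr rfl fun w _ => ?_
    simp only [star_add]
    ring

theorem wordForm_smul_left (c : ℂ) (x y : List E →₀ ℂ) :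
    wordForm (c • x) y = star c * wordForm x y := by
  refine (Finsupp.sum_smul_index' (fun v => ?_)).trans ?_
  · simp
  · rw [wordForm, Finsupp.mul_sum]
    refine Finset.sum_congr rfl fun v _ => ?_
    dsimp only
    rw [Finsupp.mul_sum]
    refine Finset.sum_congr rfl fun w _ => ?_
    simp only [smul_eq_mul, star_mul']
    ring

theorem wordForm_mapDomain (φ : List E → List E) (c : ℂ)
    (hφ : ∀ v w, wordInner (φ v) (φ w) = c * wordInner v w) (x y : List E →₀ ℂ) :
    wordForm (x.mapDomain φ) (y.mapDomain φ) = c * wordForm x y := by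
  refine (Finsupp.sum_mapDomain_index (fun v => ?_) (fun v a b => ?_)).trans ?_
  · simp
  · rw [← Finsupp.sum_add]
    refine Finset.sum_congr rfl fun w _ => ?_
    simp only [star_add]
    ring
  · rw [wordForm, Finsupp.mul_sum]
    refine Finset.sum_congr rfl fun v _ => ?_
    dsimp only
    rw [Finsupp.mul_sum]
    refine (Finsupp.sum_mapDomain_index (fun w => ?_) (fun w a b => ?_)).trans ?_
    · simp
    · ring
    · refine Finset.sum_congr rfl fun w _ => ?_
      dsimp only
      rw [hφ]
      ring

theorem wordForm_nonneg (x : List E →₀ ℂ) : 0 ≤ wordForm x x := by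
  classical
  set n := x.support.sup List.length with hn
  have hx : ∀ v ∈ x.support, v.length ≤ n := fun v hv => Finset.le_sup (f := List.length) hv
  have h := (wordInner_posSemidef_of_length (E := E) n).2
    (x.subtypeDomain fun v => v.length ≤ n)
  have key : ∀ g : List E → ℂ → ℂ,
      ((x.subtypeDomain fun v => v.length ≤ n).sum fun v a => g v.1 a) = x.sum g := fun g =>
    Finsupp.sum_subtypeDomain_index (fun v hv => hx v hv)
  have h2 : wordForm x x =
      ((x.subtypeDomain fun v => v.length ≤ n).sum fun v a =>
        (x.subtypeDomain fun v => v.length ≤ n).sum fun w b =>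
          star a * wordInner v.1 w.1 * b) := by
    rw [wordForm, ← key]
    refine Finset.sum_congr rfl fun v _ => ?_
    exact (key _).symm
  rw [h2]
  exact h

variable (E) in
/-- The algebraic full Fock space: formal linear combinations of elementary tensors. The semi-inner
product below identifies combinations which agree in the algebraic tensor algebra. -/
def PreFock : Type _ := List E →₀ ℂ

instance : AddCommGroup (PreFock E) := inferInstanceAs (AddCommGroup (List E →₀ ℂ))
instance : Module ℂ (PreFock E) := inferInstanceAs (Module ℂ (List E →₀ ℂ))

instance PreFock.core : PreInnerProductSpace.Core ℂ (PreFock E) where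
  inner x y := wordForm x y
  conj_inner_symm x y := wordForm_conj y x
  re_inner_nonneg x := (Complex.le_def.1 (wordForm_nonneg x)).1
  add_left x y z := wordForm_add_left x y z
  smul_left x y c := wordForm_smul_left c x y

instance : SeminormedAddCommGroup (PreFock E) :=
  InnerProductSpace.Core.toSeminormedAddCommGroup (𝕜 := ℂ)

instance : InnerProductSpace ℂ (PreFock E) := InnerProductSpace.ofCore PreFock.core

variable (E) in
/-- The full Fock space `ℂ Ω ⊕ ⨁_{n ≥ 1} E^{⊗ n}`: the (Hausdorff) completion of the linear span of
the elementary tensors. -/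
def Fock : Type _ := UniformSpace.Completion (PreFock E)

instance : NormedAddCommGroup (Fock E) :=
  inferInstanceAs (NormedAddCommGroup (UniformSpace.Completion (PreFock E)))

instance : InnerProductSpace ℂ (Fock E) :=
  inferInstanceAs (InnerProductSpace ℂ (UniformSpace.Completion (PreFock E)))

instance : CompleteSpace (Fock E) :=
  inferInstanceAs (CompleteSpace (UniformSpace.Completion (PreFock E)))

namespace PreFock

/-- The elementary tensor `e₁ ⊗ ⋯ ⊗ e_n` in the algebraic Fock space. -/
def word (v : List E) : PreFock E := Finsupp.single v (1 : ℂ)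

theorem inner_eq_wordForm (x y : PreFock E) : ⟪x, y⟫_ℂ = wordForm x y := rfl

/-- The linear map which sends each elementary tensor `v` to the elementary tensor `φ v`. -/
def mapWords (φ : List E → List E) : PreFock E →ₗ[ℂ] PreFock E := Finsupp.lmapDomain ℂ ℂ φ

theorem inner_mapWords (φ : List E → List E) (c : ℂ)
    (hφ : ∀ v w, wordInner (φ v) (φ w) = c * wordInner v w) (x y : PreFock E) :
    ⟪mapWords φ x, mapWords φ y⟫_ℂ = c * ⟪x, y⟫_ℂ :=
  wordForm_mapDomain φ c hφ x y

theorem norm_mapWords_le (φ : List E → List E) (c : ℝ) (hc : 0 ≤ c)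
    (hφ : ∀ v w, wordInner (φ v) (φ w) = ((c ^ 2 : ℝ) : ℂ) * wordInner v w) (x : PreFock E) :
    ‖mapWords φ x‖ ≤ c * ‖x‖ := by
  have h := congrArg Complex.re (inner_mapWords φ _ hφ x x)
  rw [Complex.re_ofReal_mul] at h
  have h1 := inner_self_eq_norm_sq (𝕜 := ℂ) (mapWords φ x)
  have h2 := inner_self_eq_norm_sq (𝕜 := ℂ) x
  simp only [RCLike.re_to_complex] at h1 h2
  rw [h1, h2, ← mul_pow] at h
  exact (pow_le_pow_iff_left₀ (norm_nonneg _) (by positivity) two_ne_zero).1 h.le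

end PreFock

namespace Fock

/-- The elementary tensor `e₁ ⊗ ⋯ ⊗ e_n` in the full Fock space. -/
def word (v : List E) : Fock E := ((PreFock.word v : PreFock E) : UniformSpace.Completion (PreFock E))

/-- The extension of a bounded operator from the algebraic Fock space to its completion. -/
def extend (T : PreFock E →L[ℂ] PreFock E) : Fock E →L[ℂ] Fock E := T.completion

theorem extend_word (T : PreFock E →L[ℂ] PreFock E) (v w : List E)
    (h : T (PreFock.word v) = PreFock.word w) : extend T (word v) = word w :=
  (ContinuousLinearMap.completion_apply_coe T _).trans (congrArg _ h)

variable (E) in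
/-- The vacuum vector `Ω`. -/
def vacuum : Fock E := word []

theorem inner_word (v w : List E) : ⟪word v, word w⟫_ℂ = wordInner v w := by
  refine (UniformSpace.Completion.inner_coe _ _).trans ?_
  rw [PreFock.inner_eq_wordForm]
  simp [PreFock.word, wordForm]

/-- The left creation operator: `ℓ(e) Ω = e`, `ℓ(e) (e₁ ⊗ ⋯ ⊗ e_n) = e ⊗ e₁ ⊗ ⋯ ⊗ e_n`. -/
def creation (e : E) : Fock E →L[ℂ] Fock E :=
  extend <| (PreFock.mapWords (e :: ·)).mkContinuous ‖e‖ <|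
    PreFock.norm_mapWords_le _ _ (norm_nonneg e) fun v w => by
      simp only [wordInner, inner_self_eq_norm_sq_to_K]
      simp

theorem creation_word (e : E) (v : List E) : creation e (word v) = word (e :: v) := 
  extend_word _ _ _ Finsupp.mapDomain_single

theorem wordInner_map (U : E →ₗᵢ[ℂ] E) (v w : List E) :
    wordInner (v.map U) (w.map U) = wordInner v w := by
  induction v generalizing w with
  | nil => cases w <;> simp [wordInner]
  | cons e v ih => cases w <;> simp [wordInner, ih]

/-- The second quantization `ℱ(U) = id ⊕ ⨁_{n ≥ 1} U^{⊗ n}` of a linear isometry `U`. -/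
def secondQuantization (U : E →ₗᵢ[ℂ] E) : Fock E →L[ℂ] Fock E :=
  extend <| (PreFock.mapWords (List.map U)).mkContinuous 1 <|
    PreFock.norm_mapWords_le _ _ zero_le_one fun v w => by simp [wordInner_map]

theorem secondQuantization_word (U : E →ₗᵢ[ℂ] E) (v : List E) :
    secondQuantization U (word v) = word (v.map U) := 
  extend_word _ _ _ Finsupp.mapDomain_single

end Fock

end Fock

/-! ### Von Neumann algebras and faithful normal traces -/

section VonNeumann

variable {K : Type*} [NormedAddCommGroup K] [InnerProductSpace ℂ K] [CompleteSpace K]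

/-- The von Neumann algebra generated by a set of bounded operators: the double commutant of
`S ∪ S*`. -/
def generated (S : Set (K →L[ℂ] K)) : VonNeumannAlgebra K where
  toStarSubalgebra :=
    StarSubalgebra.centralizer ℂ (StarSubalgebra.centralizer ℂ S : Set (K →L[ℂ] K))
  centralizer_centralizer' := by simp

theorem mem_generated_iff {S : Set (K →L[ℂ] K)} {x : K →L[ℂ] K} :
    x ∈ generated S ↔
      ∀ y : K →L[ℂ] K, (∀ s ∈ S, s * y = y * s ∧ star s * y = y * star s) → y * x = x * y := by
  change x ∈ StarSubalgebra.centralizer ℂ _ ↔ _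
  rw [StarSubalgebra.mem_centralizer_iff]
  constructor
  · intro h y hy
    exact (h y ((StarSubalgebra.mem_centralizer_iff ℂ).2 hy)).1
  · intro h y hy
    exact ⟨h y ((StarSubalgebra.mem_centralizer_iff ℂ).1 hy),
      h _ ((StarSubalgebra.mem_centralizer_iff ℂ).1 (star_mem hy))⟩

theorem generated_mono {S T : Set (K →L[ℂ] K)} (h : S ⊆ T) : generated S ≤ generated T :=
  fun _ hx => mem_generated_iff.2 fun y hy => mem_generated_iff.1 hx y fun s hs => hy s (h hs)

/-- The vector state `x ↦ ⟪ξ, x ξ⟫` on a von Neumann algebra. -/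
def vectorState (M : VonNeumannAlgebra K) (ξ : K) : M.toStarSubalgebra →ₗ[ℂ] ℂ where
  toFun x := ⟪ξ, (x : K →L[ℂ] K) ξ⟫_ℂ
  map_add' x y := by simp
  map_smul' c x := by simp

/-- `τ` is a faithful normal tracial state on the von Neumann algebra `M`. Normality (together with
positivity) is expressed by a representation `τ = ∑ ⟪ξ_n, · ξ_n⟫` with `∑ ‖ξ_n‖² < ∞`. -/
structure IsFaithfulNormalTrace (M : VonNeumannAlgebra K) (τ : M.toStarSubalgebra →ₗ[ℂ] ℂ) :
    Prop where
  map_one : τ 1 = 1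
  normal : ∃ ξ : ℕ → K, Summable (fun n => ‖ξ n‖ ^ 2) ∧
    ∀ x : M.toStarSubalgebra, HasSum (fun n => ⟪ξ n, (x : K →L[ℂ] K) (ξ n)⟫_ℂ) (τ x)
  faithful : ∀ x : M.toStarSubalgebra, τ (star x * x) = 0 → x = 0
  trace : ∀ x y : M.toStarSubalgebra, τ (x * y) = τ (y * x)

/-- The norm `‖x‖₂ = τ(x* x)^{1/2}`. -/
def l2Norm {M : VonNeumannAlgebra K} (τ : M.toStarSubalgebra →ₗ[ℂ] ℂ) (x : M.toStarSubalgebra) :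
    ℝ :=
  √(τ (star x * x)).re

namespace IsFaithfulNormalTrace

variable {M : VonNeumannAlgebra K} {τ : M.toStarSubalgebra →ₗ[ℂ] ℂ}

theorem exists_hasSum (h : IsFaithfulNormalTrace M τ) : ∃ ξ : ℕ → K,
    ∀ x : M.toStarSubalgebra, HasSum (fun n => ‖(x : K →L[ℂ] K) (ξ n)‖ ^ 2) (τ (star x * x)).re := by
  obtain ⟨ξ, -, hξ⟩ := h.normal
  refine ⟨ξ, fun x => ?_⟩
  have h1 := Complex.hasSum_re (hξ (star x * x))
  convert h1 using 2 with n
  have h2 : ((star x * x : M.toStarSubalgebra) : K →L[ℂ] K) (ξ n) =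
      ContinuousLinearMap.adjoint (x : K →L[ℂ] K) ((x : K →L[ℂ] K) (ξ n)) := rfl
  rw [h2, ContinuousLinearMap.adjoint_inner_right]
  exact (inner_self_eq_norm_sq (𝕜 := ℂ) _).symm

theorem nonneg (h : IsFaithfulNormalTrace M τ) (x : M.toStarSubalgebra) :
    0 ≤ (τ (star x * x)).re := by
  obtain ⟨ξ, hξ⟩ := h.exists_hasSum
  exact (hξ x).nonneg fun n => sq_nonneg _

theorem map_star (h : IsFaithfulNormalTrace M τ) (x : M.toStarSubalgebra) :
    τ (star x) = star (τ x) := by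
  obtain ⟨ξ, -, hξ⟩ := h.normal
  refine (hξ (star x)).unique ?_
  convert (hξ x).star using 2 with n
  have h2 : ((star x : M.toStarSubalgebra) : K →L[ℂ] K) (ξ n) =
      ContinuousLinearMap.adjoint (x : K →L[ℂ] K) (ξ n) := rfl
  rw [h2, ContinuousLinearMap.adjoint_inner_right]
  exact (inner_conj_symm _ _).symm

theorem l2Norm_sq (h : IsFaithfulNormalTrace M τ) (x : M.toStarSubalgebra) :
    l2Norm τ x ^ 2 = (τ (star x * x)).re :=
  Real.sq_sqrt (h.nonneg x)

theorem l2Norm_nonneg (τ : M.toStarSubalgebra →ₗ[ℂ] ℂ) (x : M.toStarSubalgebra) :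
    0 ≤ l2Norm τ x := Real.sqrt_nonneg _

theorem l2Norm_mul_le (h : IsFaithfulNormalTrace M τ) (a x : M.toStarSubalgebra) :
    l2Norm τ (a * x) ≤ ‖(a : K →L[ℂ] K)‖ * l2Norm τ x := by
  refine (pow_le_pow_iff_left₀ (l2Norm_nonneg _ _)
    (mul_nonneg (norm_nonneg _) (l2Norm_nonneg _ _)) two_ne_zero).1 ?_
  rw [mul_pow, h.l2Norm_sq, h.l2Norm_sq]
  obtain ⟨ξ, hξ⟩ := h.exists_hasSum
  refine hasSum_le (fun n => ?_) (hξ (a * x)) ((hξ x).mul_left _)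
  rw [← mul_pow]
  exact pow_le_pow_left₀ (norm_nonneg _) ((a : K →L[ℂ] K).le_opNorm _) 2

theorem l2Norm_star (h : IsFaithfulNormalTrace M τ) (x : M.toStarSubalgebra) :
    l2Norm τ (star x) = l2Norm τ x := by
  rw [l2Norm, l2Norm, star_star, h.trace]

theorem l2Norm_mul_le' (h : IsFaithfulNormalTrace M τ) (x b : M.toStarSubalgebra) :
    l2Norm τ (x * b) ≤ ‖(b : K →L[ℂ] K)‖ * l2Norm τ x := by
  rw [← h.l2Norm_star, star_mul, ← h.l2Norm_star x]
  refine (h.l2Norm_mul_le _ _).trans_eq ?_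
  congr 1
  exact norm_star (b : K →L[ℂ] K)

theorem l2Norm_add_sq_le (h : IsFaithfulNormalTrace M τ) (x y : M.toStarSubalgebra) :
    l2Norm τ (x + y) ^ 2 ≤ 2 * (l2Norm τ x ^ 2 + l2Norm τ y ^ 2) := by
  have h1 := h.nonneg (x - y)
  simp only [h.l2Norm_sq]
  simp only [star_sub, star_add, sub_mul, mul_sub, add_mul, mul_add, map_sub, map_add,
    Complex.sub_re, Complex.add_re] at h1 ⊢
  linarith

theorem norm_apply_le_l2Norm (h : IsFaithfulNormalTrace M τ) (x : M.toStarSubalgebra) :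
    ‖τ x‖ ≤ l2Norm τ x := by
  refine (pow_le_pow_iff_left₀ (norm_nonneg _) (l2Norm_nonneg _ _) two_ne_zero).1 ?_
  have h1 := h.nonneg (x - τ x • 1)
  rw [h.l2Norm_sq, ← Complex.normSq_eq_norm_sq, Complex.normSq_apply]
  simp only [star_sub, star_smul, star_one, sub_mul, mul_sub, map_sub, smul_mul_assoc, one_mul,
    mul_smul_comm, mul_one, map_smul, h.map_star, h.map_one, smul_eq_mul, Complex.sub_re,
    Complex.mul_re, RCLike.star_def, Complex.conj_re, Complex.conj_im] at h1
  linarith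

theorem l2Norm_le_norm (h : IsFaithfulNormalTrace M τ) (x : M.toStarSubalgebra) :
    l2Norm τ x ≤ ‖(x : K →L[ℂ] K)‖ := by
  have h1 := h.l2Norm_mul_le x 1
  have h2 : l2Norm τ (1 : M.toStarSubalgebra) = 1 := by simp [l2Norm, h.map_one]
  rwa [mul_one, h2, mul_one] at h1

end IsFaithfulNormalTrace

/-! ### The tracial ultraproduct -/

open Filter Topology

/-- The norm bounded sequences in `M`, as a `*`-subalgebra of `M^ℕ`. -/
def boundedSubalgebra (M : VonNeumannAlgebra K) : StarSubalgebra ℂ (ℕ → M.toStarSubalgebra) where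
  carrier := {x | ∃ C : ℝ, ∀ n, ‖(x n : K →L[ℂ] K)‖ ≤ C}
  mul_mem' := by
    rintro x y ⟨C, hC⟩ ⟨D, hD⟩
    exact ⟨C * D, fun n => (norm_mul_le _ _).trans (mul_le_mul (hC n) (hD n) (norm_nonneg _)
      ((norm_nonneg _).trans (hC n)))⟩
  add_mem' := by
    rintro x y ⟨C, hC⟩ ⟨D, hD⟩
    exact ⟨C + D, fun n => (norm_add_le _ _).trans (add_le_add (hC n) (hD n))⟩
  algebraMap_mem' c := ⟨‖algebraMap ℂ (K →L[ℂ] K) c‖, fun n => le_rfl⟩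
  star_mem' := by
    rintro x ⟨C, hC⟩
    exact ⟨C, fun n => (norm_star (x n : K →L[ℂ] K)).trans_le (hC n)⟩

/-- The `*`-algebra `ℓ^∞(ℕ, M)` of norm bounded sequences in `M`. -/
def BoundedSeq (M : VonNeumannAlgebra K) : Type _ := boundedSubalgebra M

namespace BoundedSeq

variable {M : VonNeumannAlgebra K}

instance : Ring (BoundedSeq M) := inferInstanceAs (Ring (boundedSubalgebra M))
instance : StarRing (BoundedSeq M) := inferInstanceAs (StarRing (boundedSubalgebra M))
instance : Algebra ℂ (BoundedSeq M) := inferInstanceAs (Algebra ℂ (boundedSubalgebra M))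

instance : CoeFun (BoundedSeq M) fun _ => ℕ → M.toStarSubalgebra := ⟨fun x => x.1⟩

theorem exists_bound (x : BoundedSeq M) : ∃ C : ℝ, ∀ n, ‖(x n : K →L[ℂ] K)‖ ≤ C := x.2

/-- The constant sequence `a`. -/
def const (a : M.toStarSubalgebra) : BoundedSeq M :=
  ⟨fun _ => a, ‖(a : K →L[ℂ] K)‖, fun _ => le_rfl⟩

@[simp] theorem const_apply (a : M.toStarSubalgebra) (n : ℕ) : const a n = a := rfl
@[simp] theorem zero_apply (n : ℕ) : (0 : BoundedSeq M) n = 0 := rfl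
@[simp] theorem one_apply (n : ℕ) : (1 : BoundedSeq M) n = 1 := rfl
@[simp] theorem add_apply (x y : BoundedSeq M) (n : ℕ) : (x + y) n = x n + y n := rfl
@[simp] theorem sub_apply (x y : BoundedSeq M) (n : ℕ) : (x - y) n = x n - y n := rfl
@[simp] theorem mul_apply (x y : BoundedSeq M) (n : ℕ) : (x * y) n = x n * y n := rfl
@[simp] theorem star_apply (x : BoundedSeq M) (n : ℕ) : (star x) n = star (x n) := rfl
@[simp] theorem smul_apply (c : ℂ) (x : BoundedSeq M) (n : ℕ) : (c • x) n = c • x n := rfl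

end BoundedSeq

variable {M : VonNeumannAlgebra K} {τ : M.toStarSubalgebra →ₗ[ℂ] ℂ}

/-- The ideal of the bounded sequences `(x_n)` with `lim_{n → ω} ‖x_n‖₂ = 0`. -/
def nullIdeal (h : IsFaithfulNormalTrace M τ) (ω : Ultrafilter ℕ) : Ideal (BoundedSeq M) where
  carrier := {x | Tendsto (fun n => l2Norm τ (x n)) ω (𝓝 0)}
  zero_mem' := by simp [l2Norm]
  add_mem' := by
    intro x y hx hy
    have h1 : Tendsto (fun n => √(2 * (l2Norm τ (x n) ^ 2 + l2Norm τ (y n) ^ 2))) ω (𝓝 0) := by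
      simpa using (((Tendsto.pow hx 2).add (Tendsto.pow hy 2)).const_mul 2).sqrt
    exact squeeze_zero (fun n => Real.sqrt_nonneg _)
      (fun n => Real.le_sqrt_of_sq_le (h.l2Norm_add_sq_le _ _)) h1
  smul_mem' := by
    intro a x hx
    obtain ⟨C, hC⟩ := a.exists_bound
    refine squeeze_zero (fun n => Real.sqrt_nonneg _) (fun n => ?_)
      (by simpa using Tendsto.const_mul C hx)
    exact (h.l2Norm_mul_le _ _).trans
      (mul_le_mul_of_nonneg_right (hC n) (Real.sqrt_nonneg _))

instance (h : IsFaithfulNormalTrace M τ) (ω : Ultrafilter ℕ) : (nullIdeal h ω).IsTwoSided where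
  mul_mem_of_left := by
    intro x b hx
    obtain ⟨C, hC⟩ := b.exists_bound
    refine squeeze_zero (fun n => Real.sqrt_nonneg _) (fun n => ?_)
      (by simpa using Tendsto.const_mul C hx)
    exact (h.l2Norm_mul_le' _ _).trans
      (mul_le_mul_of_nonneg_right (hC n) (Real.sqrt_nonneg _))

/-- The tracial ultraproduct `M^ω = ℓ^∞(ℕ, M) / {(x_n) : lim_{n → ω} ‖x_n‖₂ = 0}`. -/
def Ultraproduct (h : IsFaithfulNormalTrace M τ) (ω : Ultrafilter ℕ) : Type _ :=
  BoundedSeq M ⧸ nullIdeal h ω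

namespace Ultraproduct

variable (h : IsFaithfulNormalTrace M τ) (ω : Ultrafilter ℕ)

instance : Ring (Ultraproduct h ω) := Ideal.Quotient.ring (nullIdeal h ω)

instance : Algebra ℂ (Ultraproduct h ω) :=
  inferInstanceAs (Algebra ℂ (BoundedSeq M ⧸ nullIdeal h ω))

/-- The class of a bounded sequence in the ultraproduct. -/
def mk : BoundedSeq M →ₐ[ℂ] Ultraproduct h ω := Ideal.Quotient.mkₐ ℂ (nullIdeal h ω)

theorem mk_surjective : Function.Surjective (mk h ω) := Ideal.Quotient.mk_surjective

theorem mk_eq_mk_iff {x y : BoundedSeq M} :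
    mk h ω x = mk h ω y ↔ Tendsto (fun n => l2Norm τ (x n - y n)) ω (𝓝 0) :=
  Ideal.Quotient.eq (I := nullIdeal h ω)

/-- The embedding of `M` in `M^ω` by constant sequences. -/
def ofConst (a : M.toStarSubalgebra) : Ultraproduct h ω := mk h ω (.const a)

/-- The involution `(x_n)* = (x_n*)`. -/
instance : Star (Ultraproduct h ω) where
  star := Quotient.map' star fun x y hxy => by
    have h1 : mk h ω x = mk h ω y := Quotient.sound hxy
    refine Quotient.exact (s := Submodule.quotientRel (nullIdeal h ω)) ?_
    refine (mk_eq_mk_iff h ω (x := star x) (y := star y)).2 ?_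
    refine Tendsto.congr (fun n => ?_) ((mk_eq_mk_iff h ω).1 h1)
    rw [← h.l2Norm_star, star_sub]
    rfl

theorem star_mk (x : BoundedSeq M) : star (mk h ω x) = mk h ω (star x) := rfl

instance : StarRing (Ultraproduct h ω) where
  star_involutive x := by
    obtain ⟨x, rfl⟩ := mk_surjective h ω x
    rw [star_mk, star_mk, star_star]
  star_mul x y := by
    obtain ⟨x, rfl⟩ := mk_surjective h ω x
    obtain ⟨y, rfl⟩ := mk_surjective h ω y
    rw [← map_mul, star_mk, star_mul, map_mul, star_mk, star_mk]
  star_add x y := by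
    obtain ⟨x, rfl⟩ := mk_surjective h ω x
    obtain ⟨y, rfl⟩ := mk_surjective h ω y
    rw [← map_add, star_mk, star_add, map_add, star_mk, star_mk]

theorem exists_tendsto_trace (h : IsFaithfulNormalTrace M τ) (ω : Ultrafilter ℕ)
    (x : BoundedSeq M) : ∃ l : ℂ, Tendsto (fun n => τ (x n)) ω (𝓝 l) := by
  obtain ⟨C, hC⟩ := x.exists_bound
  have hmem : ∀ n, τ (x n) ∈ Metric.closedBall (0 : ℂ) C := fun n => by
    rw [mem_closedBall_zero_iff]
    exact ((h.norm_apply_le_l2Norm _).trans (h.l2Norm_le_norm _)).trans (hC n)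
  obtain ⟨l, -, hl⟩ := (isCompact_closedBall (0 : ℂ) C).ultrafilter_le_nhds
    (ω.map fun n => τ (x n)) (by
      rw [le_principal_iff]
      exact Filter.mem_map.2 (Filter.univ_mem' hmem))
  exact ⟨l, hl⟩

/-- The trace `τ_ω` on `M^ω`: the class of `(x_n)` is mapped to `lim_{n → ω} τ(x_n)`. -/
def trace : Ultraproduct h ω → ℂ :=
  Quotient.lift (fun x : BoundedSeq M => limUnder (ω : Filter ℕ) fun n => τ (x n)) <| by
    intro x y hxy
    have hxy' := (mk_eq_mk_iff h ω).1 (Quotient.sound hxy : mk h ω x = mk h ω y)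
    obtain ⟨l, hl⟩ := exists_tendsto_trace h ω y
    have h1 : Tendsto (fun n => τ (x n - y n)) ω (𝓝 0) :=
      squeeze_zero_norm (fun n => h.norm_apply_le_l2Norm _) hxy'
    have h2 : Tendsto (fun n => τ (x n)) ω (𝓝 l) := by
      have h3 := h1.add hl
      rw [zero_add] at h3
      refine h3.congr fun n => ?_
      rw [← map_add, sub_add_cancel]
    exact h2.limUnder_eq.trans hl.limUnder_eq.symm

theorem tendsto_trace (x : BoundedSeq M) :
    Tendsto (fun n => τ (x n)) ω (𝓝 (trace h ω (mk h ω x))) :=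
  tendsto_nhds_limUnder (exists_tendsto_trace h ω x)

/-- The inner product of `L²(M^ω, τ_ω)` on `M^ω`, conjugate linear in the first variable. -/
def l2Inner (x y : Ultraproduct h ω) : ℂ := trace h ω (star x * y)

/-- The ultraproduct `A^ω` inside `M^ω`: the classes of the bounded sequences in `A`. -/
def sub (A : VonNeumannAlgebra K) : Set (Ultraproduct h ω) :=
  {x | ∃ z : BoundedSeq M, (∀ n, (z n : K →L[ℂ] K) ∈ A) ∧ mk h ω z = x}

/-- `M^ω ⊖ A^ω`: the elements of `M^ω` which are orthogonal to `A^ω`. -/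
def orthogonal (A : VonNeumannAlgebra K) : Set (Ultraproduct h ω) :=
  {x | ∀ z ∈ sub h ω A, l2Inner h ω z x = 0}

/-- `A' ∩ M^ω`: the elements of `M^ω` which commute with (the constant sequences in) `A`. -/
def relCommutant (A : VonNeumannAlgebra K) : Set (Ultraproduct h ω) :=
  {x | ∀ c : M.toStarSubalgebra, (c : K →L[ℂ] K) ∈ A → ofConst h ω c * x = x * ofConst h ω c}

end Ultraproduct

/-- `M ⊖ A`: the elements of `M` which are orthogonal to `A` with respect to the trace `τ`. -/
def orthogonalPart (τ : M.toStarSubalgebra →ₗ[ℂ] ℂ) (A : VonNeumannAlgebra K) :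
    Set M.toStarSubalgebra :=
  {a | ∀ c : M.toStarSubalgebra, (c : K →L[ℂ] K) ∈ A → τ (star c * a) = 0}

/-- The asymptotic orthogonality property of a von Neumann subalgebra `A` of a von Neumann algebra
`M` with faithful normal tracial state `τ`: there is a free ultrafilter `ω` on `ℕ` such that
`a x ⟂ y b` in `L²(M^ω, τ_ω)` for all `x, y ∈ (M^ω ⊖ A^ω) ∩ A'` and all `a, b ∈ M ⊖ A`. -/
def HasAsymptoticOrthogonality (h : IsFaithfulNormalTrace M τ) (A : VonNeumannAlgebra K) : Prop :=
  A ≤ M ∧ ∃ ω : Ultrafilter ℕ, (ω : Filter ℕ) ≤ cofinite ∧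
    ∀ x ∈ Ultraproduct.orthogonal h ω A ∩ Ultraproduct.relCommutant h ω A,
    ∀ y ∈ Ultraproduct.orthogonal h ω A ∩ Ultraproduct.relCommutant h ω A,
    ∀ a ∈ orthogonalPart τ A, ∀ b ∈ orthogonalPart τ A,
      Ultraproduct.l2Inner h ω (Ultraproduct.ofConst h ω a * x)
        (y * Ultraproduct.ofConst h ω b) = 0

end VonNeumann

/-! ### The crossed product by the free Bogoljubov action -/

section CrossedProduct

variable {G : Type*} {F : Type*} [NormedAddCommGroup F]

theorem hasSum_norm_sq (ξ : lp (fun _ : G => F) 2) : HasSum (fun h => ‖ξ h‖ ^ 2) (‖ξ‖ ^ 2) := by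
  simpa using lp.hasSum_norm (p := 2) (by norm_num) ξ

variable [Group G] [InnerProductSpace ℂ F]

theorem norm_sq_tensorShift_le (T : F →L[ℂ] F) (g : G) (ξ : lp (fun _ : G => F) 2) (h : G) :
    ‖T (ξ (g⁻¹ * h))‖ ^ 2 ≤ ‖T‖ ^ 2 * ‖ξ (g⁻¹ * h)‖ ^ 2 := by
  rw [← mul_pow]
  exact pow_le_pow_left₀ (norm_nonneg _) (T.le_opNorm _) 2

theorem memℓp_tensorShift (T : F →L[ℂ] F) (g : G) (ξ : lp (fun _ : G => F) 2) :
    Memℓp (fun h => T (ξ (g⁻¹ * h))) 2 := by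
  have h1 := ((Equiv.summable_iff (f := fun h => ‖ξ h‖ ^ 2) (Equiv.mulLeft g⁻¹)).2
    (hasSum_norm_sq ξ).summable).mul_left (‖T‖ ^ 2)
  refine memℓp_gen ?_
  simpa using Summable.of_nonneg_of_le (fun _ => sq_nonneg _) (norm_sq_tensorShift_le T g ξ) h1

/-- The linear map underlying `tensorShift`. -/
def tensorShiftₗ (T : F →L[ℂ] F) (g : G) :
    lp (fun _ : G => F) 2 →ₗ[ℂ] lp (fun _ : G => F) 2 where
  toFun ξ := ⟨fun h => T (ξ (g⁻¹ * h)), memℓp_tensorShift T g ξ⟩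
  map_add' ξ η := lp.ext (funext fun h => map_add T (ξ (g⁻¹ * h)) (η (g⁻¹ * h)))
  map_smul' c ξ := lp.ext (funext fun h => map_smul T c (ξ (g⁻¹ * h)))

theorem norm_tensorShiftₗ_le (T : F →L[ℂ] F) (g : G) (ξ : lp (fun _ : G => F) 2) :
    ‖tensorShiftₗ T g ξ‖ ≤ ‖T‖ * ‖ξ‖ := by
  refine (pow_le_pow_iff_left₀ (norm_nonneg _)
    (mul_nonneg (norm_nonneg _) (norm_nonneg _)) two_ne_zero).1 ?_
  rw [mul_pow]
  have h1 : HasSum (fun h => ‖ξ (g⁻¹ * h)‖ ^ 2) (‖ξ‖ ^ 2) :=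
    (Equiv.hasSum_iff (f := fun h => ‖ξ h‖ ^ 2) (Equiv.mulLeft g⁻¹)).2 (hasSum_norm_sq ξ)
  have h2 : HasSum (fun h => ‖T (ξ (g⁻¹ * h))‖ ^ 2) (‖tensorShiftₗ T g ξ‖ ^ 2) :=
    hasSum_norm_sq (tensorShiftₗ T g ξ)
  exact hasSum_le (norm_sq_tensorShift_le T g ξ) h2 (h1.mul_left _)

/-- The operator `T ⊗ λ_g` on `F ⊗ ℓ²(G) = ℓ²(G, F)`, where `λ` is the left regular representation
of `G`: it maps `ξ ⊗ δ_h` to `T ξ ⊗ δ_{gh}`. -/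
def tensorShift (T : F →L[ℂ] F) (g : G) :
    lp (fun _ : G => F) 2 →L[ℂ] lp (fun _ : G => F) 2 :=
  (tensorShiftₗ T g).mkContinuous ‖T‖ (norm_tensorShiftₗ_le T g)

theorem tensorShift_apply (T : F →L[ℂ] F) (g h : G) (ξ : lp (fun _ : G => F) 2) :
    tensorShift T g ξ h = T (ξ (g⁻¹ * h)) := rfl

variable [CompleteSpace F]

/-- The copy of `L(G)` on `F ⊗ ℓ²(G)` generated by the unitaries `u_g = ρ(g) ⊗ λ_g`. -/
def groupAlgebra (ρ : G → F →L[ℂ] F) : VonNeumannAlgebra (lp (fun _ : G => F) 2) :=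
  generated (Set.range fun g => tensorShift (ρ g) g)

/-- The crossed product of a von Neumann algebra `Q` on `F` by the action `g ↦ Ad ρ(g)` of `G`,
where `ρ` is a unitary representation of `G` on `F` which normalizes `Q`. It is the von Neumann
algebra on `F ⊗ ℓ²(G)` generated by the operators `a ⊗ 1`, for `a ∈ Q`, and the unitaries
`u_g = ρ(g) ⊗ λ_g`, which implement the action: `u_g (a ⊗ 1) u_g* = ρ(g) a ρ(g)* ⊗ 1`. -/
def crossedProduct (Q : VonNeumannAlgebra F) (ρ : G → F →L[ℂ] F) :
    VonNeumannAlgebra (lp (fun _ : G => F) 2) :=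
  generated ({T | ∃ a ∈ Q, T = tensorShift a 1} ∪ Set.range fun g => tensorShift (ρ g) g)

theorem groupAlgebra_le (Q : VonNeumannAlgebra F) (ρ : G → F →L[ℂ] F) :
    groupAlgebra ρ ≤ crossedProduct Q ρ :=
  generated_mono Set.subset_union_right

end CrossedProduct

section FreeBogoljubov

variable {G : Type*} [Group G] {H : Type*} [NormedAddCommGroup H] [InnerProductSpace ℝ H]

/-- The semicircular operator `W(e) = ℓ(e) + ℓ(e)*`, for `e` in the real Hilbert space. -/
def semicircular (e : H) : Fock (Complexification H) →L[ℂ] Fock (Complexification H) :=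
  Fock.creation (Complexification.ofReal e) +
    ContinuousLinearMap.adjoint (Fock.creation (Complexification.ofReal e))

variable (H) in
/-- The von Neumann algebra `Γ(H)''` of the free Gaussian functor. -/
def freeGaussian : VonNeumannAlgebra (Fock (Complexification H)) :=
  generated (Set.range fun e : H => semicircular e)

/-- The unitary representation `g ↦ ℱ(π(g))` of `G` on the full Fock space, which implements the free
Bogoljubov action on `Γ(H)''`. -/
def koopman (π : G →* (H ≃ₗᵢ[ℝ] H)) (g : G) :
    Fock (Complexification H) →L[ℂ] Fock (Complexification H) :=
  Fock.secondQuantization (Complexification.map (π g))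

/-- The crossed product `Γ(H)'' ⋊_π G` by the free Bogoljubov action. -/
def bogoljubovCrossedProduct (π : G →* (H ≃ₗᵢ[ℝ] H)) :
    VonNeumannAlgebra (lp (fun _ : G => Fock (Complexification H)) 2) :=
  crossedProduct (freeGaussian H) (koopman π)

/-- The subalgebra `L(G)` of `Γ(H)'' ⋊_π G`. -/
def bogoljubovGroupAlgebra (π : G →* (H ≃ₗᵢ[ℝ] H)) :
    VonNeumannAlgebra (lp (fun _ : G => Fock (Complexification H)) 2) :=
  groupAlgebra (koopman π)

open Classical in
/-- The canonical trace of `Γ(H)'' ⋊_π G`, the vector state given by `Ω ⊗ δ_1`. -/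
def canonicalTrace (π : G →* (H ≃ₗᵢ[ℝ] H)) :
    (bogoljubovCrossedProduct π).toStarSubalgebra →ₗ[ℂ] ℂ :=
  vectorState _ (lp.single 2 (1 : G) (Fock.vacuum (Complexification H)))

/-- An orthogonal representation is mixing if its coefficients vanish at infinity. -/
def IsMixing (π : G →* (H ≃ₗᵢ[ℝ] H)) : Prop :=
  ∀ ξ η : H, Filter.Tendsto (fun g => ⟪π g ξ, η⟫_ℝ) Filter.cofinite (nhds 0)

end FreeBogoljubov

end FreeBogoljubov

end

set_option autoImplicit false

noncomputable section

namespace FreeBogoljubov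

open scoped ComplexOrder InnerProductSpace Topology
open Filter ContinuousLinearMap

/-! ### Closed subspaces and dense spans -/

/-! Everything is read off at the vector `vac` = Ω ⊗ δ_1. Since G is abelian, the commutant of M
contains the shifts 1 ⊗ λ_g; it also contains the right semicircular operators `rightOp` + adjoint,
whose letter is twisted by π(k) in coordinate k. At `vac` these reproduce the u_g and the W(e) ⊗ 1.
Hence the vector state is tracial on a dense set, then on M; and as the vectors W(v) u_g `vac` = v ⊗
δ_g have dense span, `vac` is cyclic for the commutant and the state is faithful
(`isFaithfulNormalTrace_vectorState`).

For asymptotic orthogonality put ξ_n = x_n `vac` and η_n = y_n `vac`. Commutation with L(G) makes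
both sequences asymptotically invariant under ℱ(π(g)) ⊗ 1. By mixing, a vector e has arbitrarily
many almost orthogonal translates π(g_i)e, whose creation operators have almost orthogonal ranges;
invariance gives ξ_n components of nearly equal size on all of these ranges, so each is small
(`tendsto_adjoint_of_mixing`). Thus ξ_n and η_n have asymptotically no prescribed first or last
letter. Orthogonality to L(G)^ω removes from ξ_n the component on Ω ⊗ ℓ²(G)
(`IsMixing.tendsto_vacOp`): x_n is tested against its conditional expectation, a weak limit of u_h
x_n u_h* as h → ∞ (`IsMixing.exists_expectation`).

Consequently W(v) u_g ξ_n is nearly the word v put in front of u_g ξ_n, and η_n W(w) u_h is nearly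
the (twisted) word w put behind η_n (`tendsto_wick_sub`). For nonempty w the second vector ends with
a prescribed letter, while the end of the first is inherited from ξ_n and contains no such letter
asymptotically; so the inner products vanish in the limit (`tendsto_inner_wick`). Density extends
this to a and b (`tendsto_inner_of_negligible`), traciality controlling ‖(a - p)x_n‖₂ by ‖x_n‖ ‖a -
p‖₂. -/

theorem mem_of_dense_span {V : Type*} [NormedAddCommGroup V] [NormedSpace ℂ V] {s : Set V}
    (hs : Dense (Submodule.span ℂ s : Set V)) {S : Submodule ℂ V} (hS : IsClosed (S : Set V))
    (h : s ⊆ S) (x : V) : x ∈ S := by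
  have h1 : closure (Submodule.span ℂ s : Set V) ⊆ S :=
    closure_minimal (Submodule.span_le.2 h) hS
  exact h1 (hs x)

theorem eq_of_inner_dense_span {V : Type*} [NormedAddCommGroup V] [InnerProductSpace ℂ V]
    {s : Set V} (hs : Dense (Submodule.span ℂ s : Set V)) {x y : V}
    (h : ∀ v ∈ s, ⟪v, x⟫_ℂ = ⟪v, y⟫_ℂ) : x = y := by
  refine hs.eq_of_inner_right ℂ fun v hv => ?_
  induction hv using Submodule.span_induction with
  | mem v hv => exact h v hv
  | zero => simp
  | add v w _ _ hv hw => simp only [inner_add_left] at *; rw [hv, hw]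
  | smul c v _ hv => simp only [inner_smul_left] at *; rw [hv]

/-- Convergence to zero of a bounded family of functionals may be checked on a set with dense
span. -/
theorem tendsto_zero_of_dense_span {V W ι : Type*} [NormedAddCommGroup V] [NormedSpace ℂ V]
    [NormedAddCommGroup W] [NormedSpace ℂ W]
    {s : Set V} (hs : Dense (Submodule.span ℂ s : Set V)) {l : Filter ι} (φ : ι → V →ₗ[ℂ] W)
    (C : ℝ) (hφ : ∀ i v, ‖φ i v‖ ≤ C * ‖v‖) (h : ∀ v ∈ s, Tendsto (fun i => φ i v) l (𝓝 0))
    (x : V) : Tendsto (fun i => φ i x) l (𝓝 0) := by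
  let S : Submodule ℂ V :=
    { carrier := {x | Tendsto (fun i => φ i x) l (𝓝 0)}
      add_mem' := fun {a b} ha hb => by simpa using Tendsto.add ha hb
      zero_mem' := by simp [tendsto_const_nhds]
      smul_mem' := fun c x hx => by simpa using Tendsto.const_smul hx c }
  refine mem_of_dense_span hs (S := S) ?_ h x
  refine isClosed_of_closure_subset fun y hy => ?_
  change Tendsto (fun i => φ i y) l (𝓝 0)
  rw [Metric.tendsto_nhds]
  intro ε hε
  -- The constant C may vanish or be negative; |C| + 1 is a safe divisor.
  have hC : 0 < |C| + 1 := by positivity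
  obtain ⟨z, hz, hyz⟩ := Metric.mem_closure_iff.1 hy (ε / 2 / (|C| + 1)) (by positivity)
  have hz' : Tendsto (fun i => φ i z) l (𝓝 0) := hz
  filter_upwards [(Metric.tendsto_nhds.1 hz') (ε / 2) (by positivity)] with i hi
  rw [dist_zero_right] at hi ⊢
  have h1 : φ i y = φ i (y - z) + φ i z := by simp
  rw [dist_eq_norm] at hyz
  have h2 : ‖φ i (y - z)‖ ≤ ε / 2 := by
    refine (hφ i _).trans ?_
    calc C * ‖y - z‖ ≤ (|C| + 1) * (ε / 2 / (|C| + 1)) := by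
          refine mul_le_mul ?_ hyz.le (norm_nonneg _) hC.le
          linarith [le_abs_self C]
      _ = ε / 2 := by field_simp
  rw [h1]
  linarith [norm_add_le (φ i (y - z)) (φ i z)]

/-! ### Operators on the full Fock space -/

section Fock

variable {E : Type*} [NormedAddCommGroup E] [InnerProductSpace ℂ E]

theorem wordInner_append (v w : List E) (e f : E) :
    wordInner (v ++ [e]) (w ++ [f]) = ⟪e, f⟫_ℂ * wordInner v w := by
  induction v generalizing w with
  | nil =>
    cases w with
    | nil => simp [wordInner]
    | cons h w => cases w <;> simp [wordInner]
  | cons h v ih =>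
    cases w with
    | nil => cases v <;> simp [wordInner]
    | cons k w =>
      simp only [List.cons_append, wordInner, ih]
      ring

theorem wordInner_append_self (e : E) (v w : List E) :
    wordInner (v ++ [e]) (w ++ [e]) = ((‖e‖ ^ 2 : ℝ) : ℂ) * wordInner v w := by
  rw [wordInner_append, inner_self_eq_norm_sq_to_K]
  simp

namespace Fock

theorem dense_span_words : Dense (Submodule.span ℂ (Set.range (word : List E → Fock E)) :
    Set (Fock E)) := by
  have h1 : ∀ x : PreFock E, ((x : UniformSpace.Completion (PreFock E)) : Fock E) ∈
      Submodule.span ℂ (Set.range (word : List E → Fock E)) := by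
    intro x
    have h2 : x ∈ Submodule.span ℂ (Set.range (PreFock.word : List E → PreFock E)) := by
      have h3 : (x : List E →₀ ℂ) = Finsupp.sum x fun v c => c • Finsupp.single v (1 : ℂ) := by
        simp only [Finsupp.smul_single, smul_eq_mul, mul_one]
        exact (Finsupp.sum_single (x : List E →₀ ℂ)).symm
      have h4 : x = Finsupp.sum x fun v c => c • PreFock.word v := h3
      rw [h4]
      exact Submodule.sum_mem _ fun v _ =>
        Submodule.smul_mem _ _ (Submodule.subset_span ⟨v, rfl⟩)
    induction h2 using Submodule.span_induction with
    | mem x hx =>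
      obtain ⟨v, rfl⟩ := hx
      exact Submodule.subset_span ⟨v, rfl⟩
    | zero => exact Submodule.zero_mem _
    | add x y _ _ hx hy =>
      have h3 := Submodule.add_mem _ hx hy
      exact (UniformSpace.Completion.coe_add x y).symm ▸ h3
    | smul c x _ hx =>
      have h3 := Submodule.smul_mem _ c hx
      exact (UniformSpace.Completion.coe_smul c x).symm ▸ h3
  have h2 : DenseRange (fun x : PreFock E => (x : UniformSpace.Completion (PreFock E))) :=
    UniformSpace.Completion.denseRange_coe
  refine Dense.mono ?_ h2
  rintro _ ⟨x, rfl⟩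
  exact h1 x

theorem ext_words {W : Type*} [NormedAddCommGroup W] [NormedSpace ℂ W]
    {S T : Fock E →L[ℂ] W} (h : ∀ v, S (word v) = T (word v)) : S = T :=
  ContinuousLinearMap.ext_on dense_span_words (by rintro _ ⟨v, rfl⟩; exact h v)

theorem eq_of_inner_words {x y : Fock E} (h : ∀ v, ⟪word v, x⟫_ℂ = ⟪word v, y⟫_ℂ) : x = y :=
  eq_of_inner_dense_span dense_span_words (by rintro _ ⟨v, rfl⟩; exact h v)

/-- Two operators are equal if they have the same matrix coefficients at words. -/
theorem ext_inner_words {S T : Fock E →L[ℂ] Fock E}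
    (h : ∀ v w, ⟪word v, S (word w)⟫_ℂ = ⟪word v, T (word w)⟫_ℂ) : S = T :=
  ext_words fun w => eq_of_inner_words fun v => h v w

/-- Words are formal symbols, so linearity in a letter is not built in. It holds because the
completion is Hausdorff and `wordInner` is linear in each letter of its second argument. -/
theorem word_cons_add_smul (e f : E) (c : ℂ) (v : List E) :
    word ((e + c • f) :: v) = word (e :: v) + c • word (f :: v) := by
  refine eq_of_inner_words fun w => ?_
  cases w with
  | nil => simp [inner_word, wordInner]
  | cons g w =>
    simp only [inner_word, wordInner, inner_add_right, inner_smul_right]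
    ring

theorem creation_add_smul (e f : E) (c : ℂ) :
    creation (e + c • f) = creation e + c • creation f := by
  refine ext_words fun v => ?_
  simp [creation_word, word_cons_add_smul]

/-- The right creation operator: `r(e) (e₁ ⊗ ⋯ ⊗ e_n) = e₁ ⊗ ⋯ ⊗ e_n ⊗ e`. -/
def rightCreation (e : E) : Fock E →L[ℂ] Fock E :=
  extend <| (PreFock.mapWords (· ++ [e])).mkContinuous ‖e‖ <|
    PreFock.norm_mapWords_le (· ++ [e]) ‖e‖ (norm_nonneg e) (wordInner_append_self e)

theorem rightCreation_word (e : E) (v : List E) :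
    rightCreation e (word v) = word (v ++ [e]) :=
  extend_word _ _ _ Finsupp.mapDomain_single

theorem adjoint_creation_mul_creation (e f : E) :
    adjoint (creation e) * creation f = ⟪e, f⟫_ℂ • 1 := by
  refine ext_inner_words fun v w => ?_
  rw [mul_apply_eq_comp, adjoint_inner_right, creation_word, creation_word]
  simp [inner_word, wordInner]

theorem adjoint_rightCreation_mul_rightCreation (e f : E) :
    adjoint (rightCreation e) * rightCreation f = ⟪e, f⟫_ℂ • 1 := by
  refine ext_inner_words fun v w => ?_
  rw [mul_apply_eq_comp, adjoint_inner_right, rightCreation_word, rightCreation_word]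
  simp [inner_word, wordInner_append]

theorem adjoint_creation_vacuum (e : E) : adjoint (creation e) (vacuum E) = 0 := by
  refine eq_of_inner_words fun v => ?_
  rw [adjoint_inner_right, creation_word, vacuum, inner_word]
  simp [wordInner]

theorem adjoint_rightCreation_vacuum (e : E) : adjoint (rightCreation e) (vacuum E) = 0 := by
  refine eq_of_inner_words fun v => ?_
  rw [adjoint_inner_right, rightCreation_word, vacuum, inner_word]
  cases v <;> simp [wordInner]

theorem norm_vacuum : ‖vacuum E‖ = 1 := by
  have h : ‖vacuum E‖ ^ 2 = 1 := by
    have h1 := inner_self_eq_norm_sq_to_K (𝕜 := ℂ) (vacuum E)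
    rw [vacuum, inner_word] at h1
    simp only [wordInner] at h1
    have h2 := (congrArg Complex.re h1).symm
    norm_cast at h2
  exact (pow_eq_one_iff_of_nonneg (norm_nonneg _) two_ne_zero).1 h

theorem norm_rightCreation_le (e : E) : ‖rightCreation e‖ ≤ ‖e‖ := by
  refine opNorm_le_bound _ (norm_nonneg _) fun x => ?_
  have h := congrArg Complex.re (congrArg (fun T => ⟪x, T x⟫_ℂ)
    (adjoint_rightCreation_mul_rightCreation e e))
  simp only [mul_apply_eq_comp, adjoint_inner_right] at h
  rw [inner_self_eq_norm_sq_to_K] at h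
  simp only [smul_apply, one_apply_eq_self, inner_smul_right, inner_self_eq_norm_sq_to_K] at h
  norm_cast at h
  rw [← mul_pow] at h
  exact (pow_le_pow_iff_left₀ (norm_nonneg _) (by positivity) two_ne_zero).1 h.le

/-- The projection onto the vacuum vector. -/
def vacuumProj (E : Type*) [NormedAddCommGroup E] [InnerProductSpace ℂ E] : Fock E →L[ℂ] Fock E :=
  (innerSL ℂ (vacuum E)).smulRight (vacuum E)

theorem vacuumProj_apply (x : Fock E) : vacuumProj E x = ⟪vacuum E, x⟫_ℂ • vacuum E := rfl

theorem adjoint_vacuumProj : adjoint (vacuumProj E) = vacuumProj E := by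
  refine ((eq_adjoint_iff _ _).2 fun x y => ?_).symm
  simp only [vacuumProj_apply, inner_smul_left, inner_smul_right, inner_conj_symm]
  ring

theorem vacuumProj_word_nil : vacuumProj E (word []) = word [] := by
  rw [vacuumProj_apply, vacuum, inner_word, wordInner, one_smul]

theorem vacuumProj_word_cons (e : E) (v : List E) : vacuumProj E (word (e :: v)) = 0 := by
  simp [vacuumProj_apply, vacuum, inner_word, wordInner]

theorem vacuumProj_word_append (e : E) (v : List E) : vacuumProj E (word (v ++ [e])) = 0 := by
  cases v <;> exact vacuumProj_word_cons _ _

theorem vacuumProj_mul_creation (e : E) : vacuumProj E * creation e = 0 := by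
  refine ext_words fun v => ?_
  simp [mul_apply_eq_comp, creation_word, vacuumProj_word_cons]

theorem creation_mul_rightCreation (e f : E) :
    creation e * rightCreation f = rightCreation f * creation e := by
  refine ext_words fun v => ?_
  simp [mul_apply_eq_comp, creation_word, rightCreation_word]

theorem adjoint_rightCreation_word_append (e f : E) (v : List E) :
    adjoint (rightCreation e) (word (v ++ [f])) = ⟪e, f⟫_ℂ • word v := by
  rw [← rightCreation_word, ← mul_apply_eq_comp, adjoint_rightCreation_mul_rightCreation]
  simp

/-- The letter put in front is also the last letter only when the word was empty, so exchanging the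
two operators costs a term on the vacuum alone. This term is why components on Ω ⊗ ℓ²(G) must be
controlled later. -/
theorem adjoint_rightCreation_mul_creation (e f : E) :
    adjoint (rightCreation e) * creation f =
      creation f * adjoint (rightCreation e) + ⟪e, f⟫_ℂ • vacuumProj E := by
  refine ext_words fun v => ?_
  rcases List.eq_nil_or_concat v with rfl | ⟨w, g, rfl⟩
  · have h1 : adjoint (rightCreation e) (word []) = 0 := adjoint_rightCreation_vacuum e
    have h2 := adjoint_rightCreation_word_append e f []
    rw [List.nil_append] at h2
    simp [mul_apply_eq_comp, creation_word, h1, h2, vacuumProj_word_nil]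
  · have h2 := adjoint_rightCreation_word_append e g (f :: w)
    rw [List.cons_append] at h2
    simp [mul_apply_eq_comp, creation_word, adjoint_rightCreation_word_append, h2,
      vacuumProj_word_append]

theorem adjoint_creation_mul_rightCreation (e f : E) :
    adjoint (creation f) * rightCreation e =
      rightCreation e * adjoint (creation f) + ⟪f, e⟫_ℂ • vacuumProj E := by
  have h := congrArg adjoint (adjoint_rightCreation_mul_creation e f)
  simp only [← star_eq_adjoint, star_mul, star_add, star_star, star_smul] at h
  rw [star_eq_adjoint (vacuumProj E), adjoint_vacuumProj] at h
  simpa [star_eq_adjoint] using h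

theorem adjoint_creation_mul_adjoint_rightCreation (e f : E) :
    adjoint (creation f) * adjoint (rightCreation e) =
      adjoint (rightCreation e) * adjoint (creation f) := by
  have h := congrArg adjoint (creation_mul_rightCreation f e)
  simp only [← star_eq_adjoint, star_mul] at h
  exact h.symm

theorem secondQuantization_mul_creation (U : E →ₗᵢ[ℂ] E) (e : E) :
    secondQuantization U * creation e = creation (U e) * secondQuantization U := by
  refine ext_words fun v => ?_
  simp [mul_apply_eq_comp, creation_word, secondQuantization_word]

theorem secondQuantization_mul_rightCreation (U : E →ₗᵢ[ℂ] E) (e : E) :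
    secondQuantization U * rightCreation e = rightCreation (U e) * secondQuantization U := by
  refine ext_words fun v => ?_
  simp [mul_apply_eq_comp, rightCreation_word, secondQuantization_word]

theorem adjoint_secondQuantization_mul_self (U : E →ₗᵢ[ℂ] E) :
    adjoint (secondQuantization U) * secondQuantization U = 1 := by
  refine ext_inner_words fun v w => ?_
  rw [mul_apply_eq_comp, adjoint_inner_right, secondQuantization_word, secondQuantization_word,
    inner_word, wordInner_map]
  simp [inner_word]

end Fock

end Fock

/-! ### The real structure, the free Gaussian functor and the representation on the Fock space -/

section Gaussian

variable {H : Type*} [NormedAddCommGroup H] [InnerProductSpace ℝ H]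

local notation "F" => Fock (Complexification H)

open Complexification (ofReal)

theorem inner_ofReal (e f : H) : ⟪ofReal e, ofReal f⟫_ℂ = (⟪e, f⟫_ℝ : ℂ) := by
  rw [Complexification.inner_def]
  apply Complex.ext <;> simp [ofReal]

theorem norm_ofReal (e : H) : ‖ofReal e‖ = ‖e‖ := by
  have h := inner_self_eq_norm_sq_to_K (𝕜 := ℂ) (ofReal e)
  rw [inner_ofReal, real_inner_self_eq_norm_sq] at h
  have h1 := congrArg Complex.re h
  norm_cast at h1
  exact ((pow_left_inj₀ (norm_nonneg _) (norm_nonneg _) two_ne_zero).1 h1).symm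

theorem Complexification.eq_add_smul (x : Complexification H) :
    x = ofReal x.re + Complex.I • ofReal x.im := by
  ext <;> simp [ofReal]

/-- The elementary tensor of real vectors. -/
def realWord (v : List H) : F := Fock.word (v.map ofReal)

/-- W(e) exists only for real e. The span is stable under ℓ(e) for real e, and ℓ is complex linear,
so a complex letter can be split into its real and imaginary parts. -/
theorem word_mem_span_realWord (v : List (Complexification H)) :
    Fock.word v ∈ Submodule.span ℂ (Set.range (realWord : List H → F)) := by
  have key : ∀ (e : H) (x : F), x ∈ Submodule.span ℂ (Set.range (realWord : List H → F)) →
      Fock.creation (ofReal e) x ∈ Submodule.span ℂ (Set.range (realWord : List H → F)) := by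
    intro e x hx
    induction hx using Submodule.span_induction with
    | mem x hx =>
      obtain ⟨w, rfl⟩ := hx
      refine Submodule.subset_span ⟨e :: w, ?_⟩
      simp [realWord, Fock.creation_word]
    | zero => simp
    | add x y _ _ hx hy => rw [map_add]; exact Submodule.add_mem _ hx hy
    | smul c x _ hx => rw [map_smul]; exact Submodule.smul_mem _ c hx
  induction v with
  | nil => exact Submodule.subset_span ⟨[], rfl⟩
  | cons e v ih =>
    rw [← Fock.creation_word, Complexification.eq_add_smul e, Fock.creation_add_smul]
    exact Submodule.add_mem _ (key _ _ ih) (Submodule.smul_mem _ _ (key _ _ ih))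

theorem dense_span_realWord :
    Dense (Submodule.span ℂ (Set.range (realWord : List H → F)) : Set F) := by
  refine Fock.dense_span_words.mono ?_
  refine Submodule.span_le.2 ?_
  rintro _ ⟨v, rfl⟩
  exact word_mem_span_realWord v

/-- The right semicircular operator `r(e) + r(e)*`. -/
def rightSemicircular (e : H) : F →L[ℂ] F :=
  Fock.rightCreation (ofReal e) + adjoint (Fock.rightCreation (ofReal e))

/-- Two vacuum corrections arise, one from r* ℓ and one from ℓ* r. Their coefficients agree because
inner products of real vectors are symmetric, so they cancel in the commutator. -/
theorem semicircular_mul_rightSemicircular (e f : H) :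
    semicircular e * rightSemicircular f = rightSemicircular f * semicircular e := by
  simp only [semicircular, rightSemicircular, mul_add, add_mul,
    Fock.creation_mul_rightCreation, Fock.adjoint_creation_mul_adjoint_rightCreation,
    Fock.adjoint_creation_mul_rightCreation, Fock.adjoint_rightCreation_mul_creation, inner_ofReal,
    real_inner_comm]
  abel

theorem star_semicircular (e : H) : star (semicircular e) = semicircular e := by
  simp only [semicircular, ← star_eq_adjoint, star_add, star_star]
  rw [add_comm]

theorem subset_generated {K : Type*} [NormedAddCommGroup K] [InnerProductSpace ℂ K]
    [CompleteSpace K] {S : Set (K →L[ℂ] K)} {x : K →L[ℂ] K} (hx : x ∈ S) : x ∈ generated S :=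
  mem_generated_iff.2 fun _ hy => (hy x hx).1.symm

theorem mul_comm_rightSemicircular {a : F →L[ℂ] F} (ha : a ∈ freeGaussian H) (f : H) :
    rightSemicircular f * a = a * rightSemicircular f := by
  refine mem_generated_iff.1 ha _ ?_
  rintro _ ⟨e, rfl⟩
  dsimp only
  rw [star_semicircular]
  exact ⟨semicircular_mul_rightSemicircular e f, semicircular_mul_rightSemicircular e f⟩

/-! ### The representation of G on the Fock space and its mixing property -/

variable {G : Type*} [Group G] (π : G →* (H ≃ₗᵢ[ℝ] H))

theorem map_ofReal (U : H ≃ₗᵢ[ℝ] H) (e : H) : Complexification.map U (ofReal e) = ofReal (U e) := by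
  change (⟨U e, U 0⟩ : Complexification H) = ⟨U e, 0⟩
  simp

theorem koopman_one : koopman π 1 = 1 := by
  refine Fock.ext_words fun v => ?_
  rw [koopman, Fock.secondQuantization_word]
  have h : (fun x => Complexification.map (π 1) x) = (id : Complexification H → _) := by
    funext x
    rw [map_one]
    rfl
  change Fock.word (List.map (fun x => Complexification.map (π 1) x) v) = _
  rw [h, List.map_id]
  rfl

theorem koopman_mul (g h : G) : koopman π (g * h) = koopman π g * koopman π h := by
  refine Fock.ext_words fun v => ?_
  simp only [koopman, Fock.secondQuantization_word, mul_apply_eq_comp, List.map_map]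
  congr 2
  funext x
  simp only [Function.comp, map_mul]
  rfl

theorem adjoint_koopman (g : G) : adjoint (koopman π g) = koopman π g⁻¹ := by
  have h1 : adjoint (koopman π g) * koopman π g = 1 := Fock.adjoint_secondQuantization_mul_self _
  have h2 : koopman π g * koopman π g⁻¹ = 1 := by rw [← koopman_mul, mul_inv_cancel, koopman_one]
  exact left_inv_eq_right_inv h1 h2

theorem koopman_mul_creation (g : G) (e : H) : koopman π g * Fock.creation (ofReal e) =
    Fock.creation (ofReal (π g e)) * koopman π g := by
  rw [koopman, Fock.secondQuantization_mul_creation, map_ofReal]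

theorem koopman_mul_rightCreation (g : G) (e : H) : koopman π g * Fock.rightCreation (ofReal e) =
    Fock.rightCreation (ofReal (π g e)) * koopman π g := by
  rw [koopman, Fock.secondQuantization_mul_rightCreation, map_ofReal]

theorem koopman_vacuum (g : G) : koopman π g (Fock.vacuum _) = Fock.vacuum _ :=
  Fock.secondQuantization_word _ []

theorem norm_koopman_apply (g : G) (x : F) : ‖koopman π g x‖ = ‖x‖ := by
  have h1 : ‖koopman π g x‖ ^ 2 = ‖x‖ ^ 2 := by
    have h2 : ⟪koopman π g x, koopman π g x⟫_ℂ = ⟪x, x⟫_ℂ := by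
      rw [← adjoint_inner_right, ← mul_apply_eq_comp, koopman,
        Fock.adjoint_secondQuantization_mul_self]
      rfl
    rw [inner_self_eq_norm_sq_to_K, inner_self_eq_norm_sq_to_K] at h2
    exact_mod_cast h2
  exact (pow_left_inj₀ (norm_nonneg _) (norm_nonneg _) two_ne_zero).1 h1

variable {π}

theorem IsMixing.tendsto_inner_map (hπ : IsMixing π) (x y : Complexification H) :
    Tendsto (fun g => ⟪x, Complexification.map (π g) y⟫_ℂ) cofinite (𝓝 0) := by
  have h1 : ∀ a b : H, Tendsto (fun g => ⟪a, π g b⟫_ℝ) cofinite (𝓝 0) := fun a b => by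
    simpa only [real_inner_comm] using hπ b a
  have h2 : ∀ g, ⟪x, Complexification.map (π g) y⟫_ℂ =
      ((⟪x.re, π g y.re⟫_ℝ + ⟪x.im, π g y.im⟫_ℝ : ℝ) : ℂ) +
      ((⟪x.re, π g y.im⟫_ℝ - ⟪x.im, π g y.re⟫_ℝ : ℝ) : ℂ) * Complex.I := fun g => by
    apply Complex.ext <;> simp [Complexification.inner_def, Complexification.map]
  simp only [h2]
  have h3 := Complex.continuous_ofReal.continuousAt.tendsto.comp
    ((h1 x.re y.re).add (h1 x.im y.im))
  have h4 := Complex.continuous_ofReal.continuousAt.tendsto.comp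
    ((h1 x.re y.im).sub (h1 x.im y.re))
  simpa using h3.add (h4.mul_const Complex.I)

/-- The representation on the Fock space is mixing on the orthogonal complement of the vacuum. -/
theorem IsMixing.tendsto_inner_koopman (hπ : IsMixing π) (v : List (Complexification H)) (x : F) :
    Tendsto (fun g => ⟪Fock.word v, koopman π g x⟫_ℂ) cofinite
      (𝓝 ⟪Fock.word v, Fock.vacuumProj _ x⟫_ℂ) := by
  have h := tendsto_zero_of_dense_span Fock.dense_span_words (l := cofinite)
    (fun g : G => (innerSL ℂ (Fock.word v) ∘L
      (koopman π g - Fock.vacuumProj (Complexification H))).toLinearMap)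
    (‖Fock.word v‖ * (1 + ‖Fock.vacuumProj (Complexification H)‖)) (fun g x => ?_) ?_ x
  · rw [← tendsto_sub_nhds_zero_iff]
    simpa using h
  · refine (norm_inner_le_norm (𝕜 := ℂ) (E := F) _ _).trans ?_
    rw [mul_assoc]
    refine mul_le_mul_of_nonneg_left ?_ (norm_nonneg _)
    refine (norm_sub_le _ _).trans ?_
    rw [add_mul, one_mul]
    exact add_le_add (norm_koopman_apply π g x).le (le_opNorm _ _)
  · rintro _ ⟨w, rfl⟩
    cases w with
    | nil =>
      have h1 : ∀ g, koopman π g (Fock.word []) = Fock.word [] := koopman_vacuum π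
      simp [h1, Fock.vacuumProj_word_nil, tendsto_const_nhds]
    | cons f w =>
      cases v with
      | nil => simp [koopman, Fock.secondQuantization_word, Fock.vacuumProj_word_cons,
          Fock.inner_word, wordInner, tendsto_const_nhds]
      | cons e v =>
        -- Mixing is needed for the first letters only: their coefficient tends to zero and the
        -- remaining factor is bounded, whatever the lengths of the tails.
        have h1 : ∀ g, ⟪Fock.word (e :: v), koopman π g (Fock.word (f :: w))⟫_ℂ =
            ⟪e, Complexification.map (π g) f⟫_ℂ * ⟪Fock.word v, koopman π g (Fock.word w)⟫_ℂ := by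
          intro g
          simp [koopman, Fock.secondQuantization_word, Fock.inner_word, wordInner]
        have h2 : ∀ g : G, ‖⟪Fock.word v, koopman π g (Fock.word w)⟫_ℂ‖ ≤
            ‖Fock.word v‖ * ‖Fock.word w‖ := fun g => by
          refine (norm_inner_le_norm _ _).trans ?_
          rw [norm_koopman_apply]
        have h3 := (hπ.tendsto_inner_map e f).zero_mul_isBoundedUnder_le
          (isBoundedUnder_of ⟨_, h2⟩)
        simpa [h1, Fock.vacuumProj_word_cons] using h3

end Gaussian

section Abstract

variable {K : Type*} [NormedAddCommGroup K] [InnerProductSpace ℂ K] [CompleteSpace K]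

/-! ### Vector states which are traces -/

theorem mem_commutant_generated {S : Set (K →L[ℂ] K)} {y : K →L[ℂ] K}
    (h : ∀ s ∈ S, s * y = y * s ∧ star s * y = y * star s) : y ∈ (generated S).commutant :=
  VonNeumannAlgebra.mem_commutant_iff.2 fun _ hx => (mem_generated_iff.1 hx y h).symm

/-- The elements of `M` whose action on `Ω`, together with that of their adjoints, is implemented by
an element of the commutant. -/
def implementedAlgebra (M : VonNeumannAlgebra K) (Ω : K) : Subalgebra ℂ (K →L[ℂ] K) where
  carrier := {n | n ∈ M ∧ ∃ m ∈ M.commutant, m Ω = n Ω ∧ star m Ω = star n Ω}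
  add_mem' := by
    rintro a b ⟨ha, a', ha', h1, h2⟩ ⟨hb, b', hb', h3, h4⟩
    exact ⟨add_mem ha hb, a' + b', add_mem ha' hb', by simp [h1, h3],
      by rw [star_add, star_add, add_apply, add_apply, h2, h4]⟩
  mul_mem' := by
    rintro a b ⟨ha, a', ha', h1, h2⟩ ⟨hb, b', hb', h3, h4⟩
    refine ⟨mul_mem ha hb, b' * a', mul_mem hb' ha', ?_, ?_⟩
    · rw [mul_apply_eq_comp, h1, ← mul_apply_eq_comp,
        ← VonNeumannAlgebra.mem_commutant_iff.1 hb' a ha, mul_apply_eq_comp, h3, mul_apply_eq_comp]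
    · rw [star_mul, star_mul, mul_apply_eq_comp, h4, ← mul_apply_eq_comp,
        ← VonNeumannAlgebra.mem_commutant_iff.1 (star_mem ha') _ (star_mem hb), mul_apply_eq_comp,
        h2, mul_apply_eq_comp]
  algebraMap_mem' c := by
    refine ⟨M.toStarSubalgebra.algebraMap_mem c, algebraMap ℂ _ c,
      M.commutant.toStarSubalgebra.algebraMap_mem c, rfl, rfl⟩

section Trace

variable {M : VonNeumannAlgebra K} {Ω : K}

/-- This is τ(ny) = τ(yn): replace n by its implementing element m of the commutant, move m past y,
and return to n. -/
theorem inner_star_of_implemented {n y : K →L[ℂ] K} (hn : n ∈ implementedAlgebra M Ω)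
    (hy : y ∈ M) : ⟪star n Ω, y Ω⟫_ℂ = ⟪star y Ω, n Ω⟫_ℂ := by
  obtain ⟨-, m, hm, h1, h2⟩ := hn
  rw [← h1, ← h2, star_eq_adjoint, star_eq_adjoint, adjoint_inner_left, adjoint_inner_left,
    ← mul_apply_eq_comp, ← mul_apply_eq_comp, VonNeumannAlgebra.mem_commutant_iff.1 hm y hy]

theorem norm_star_of_implemented {n : K →L[ℂ] K} (hn : n ∈ implementedAlgebra M Ω) :
    ‖star n Ω‖ = ‖n Ω‖ := by
  have h := inner_star_of_implemented hn (star_mem hn.1)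
  rw [star_star, inner_self_eq_norm_sq_to_K, inner_self_eq_norm_sq_to_K] at h
  have h1 := congrArg Complex.re h
  norm_cast at h1
  exact (pow_left_inj₀ (norm_nonneg _) (norm_nonneg _) two_ne_zero).1 h1

variable (hd : ∀ ζ : K, ζ ∈ closure ((fun n : K →L[ℂ] K => n Ω) '' implementedAlgebra M Ω))
include hd

/-- Test m*Ω against vectors nΩ close to it, with n implemented: the trace identity and ‖n*Ω‖ = ‖nΩ‖
bound the pairing by ‖nΩ‖ ‖mΩ‖, and the limit gives ‖m*Ω‖² ≤ ‖m*Ω‖ ‖mΩ‖. -/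
theorem norm_star_apply_le {m : K →L[ℂ] K} (hm : m ∈ M) : ‖star m Ω‖ ≤ ‖m Ω‖ := by
  obtain ⟨u, hu, hlim⟩ := mem_closure_iff_seq_limit.1 (hd (star m Ω))
  have h1 : ∀ k, ‖⟪star m Ω, u k⟫_ℂ‖ ≤ ‖u k‖ * ‖m Ω‖ := by
    intro k
    obtain ⟨n, hn, hk⟩ := hu k
    dsimp only at hk
    rw [← hk, ← inner_star_of_implemented hn hm, ← norm_star_of_implemented hn]
    exact norm_inner_le_norm _ _
  have h2 : Tendsto (fun k => ‖⟪star m Ω, u k⟫_ℂ‖) atTop (𝓝 ‖⟪star m Ω, star m Ω⟫_ℂ‖) :=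
    (tendsto_const_nhds.inner hlim).norm
  have h3 := le_of_tendsto_of_tendsto' h2 (hlim.norm.mul_const _) h1
  rw [inner_self_eq_norm_sq_to_K] at h3
  by_cases h0 : ‖star m Ω‖ = 0
  · rw [h0]; exact norm_nonneg _
  · have h4 : 0 < ‖star m Ω‖ := lt_of_le_of_ne (norm_nonneg _) (Ne.symm h0)
    refine le_of_mul_le_mul_left ?_ h4
    rw [← sq]
    simpa using h3

/-- If n_k Ω → xΩ with n_k implemented, the previous estimate applied to n_k - x gives n_k*Ω → x*Ω,
and the trace identity passes to the limit. -/
theorem inner_star_comm {x y : K →L[ℂ] K} (hx : x ∈ M) (hy : y ∈ M) :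
    ⟪star x Ω, y Ω⟫_ℂ = ⟪star y Ω, x Ω⟫_ℂ := by
  obtain ⟨u, hu, hlim⟩ := mem_closure_iff_seq_limit.1 (hd (x Ω))
  choose n hn hnu using hu
  have h1 : Tendsto (fun k => star (n k) Ω) atTop (𝓝 (star x Ω)) := by
    rw [tendsto_iff_norm_sub_tendsto_zero] at hlim ⊢
    refine squeeze_zero (fun _ => norm_nonneg _) (fun k => ?_) hlim
    have h2 := norm_star_apply_le hd (sub_mem (hn k).1 hx)
    rw [star_sub] at h2
    rw [← hnu k]
    exact h2
  have h2 : Tendsto (fun k => n k Ω) atTop (𝓝 (x Ω)) := by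
    simpa only [hnu] using hlim
  refine tendsto_nhds_unique (h1.inner tendsto_const_nhds) ?_
  simp only [fun k => inner_star_of_implemented (hn k) hy]
  exact tendsto_const_nhds.inner h2

theorem isFaithfulNormalTrace_vectorState (hΩ : ‖Ω‖ = 1) :
    IsFaithfulNormalTrace M (vectorState M Ω) where
  map_one := by
    change ⟪Ω, Ω⟫_ℂ = 1
    rw [inner_self_eq_norm_sq_to_K, hΩ]
    simp
  normal := by
    refine ⟨fun n => if n = 0 then Ω else 0, ?_, fun x => ?_⟩
    · refine summable_of_ne_finset_zero (s := {0}) fun n hn => ?_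
      rw [Finset.mem_singleton] at hn
      simp [hn]
    · have h := hasSum_single (f := fun n : ℕ => ⟪(if n = 0 then Ω else 0),
        (x : K →L[ℂ] K) (if n = 0 then Ω else 0)⟫_ℂ) 0 (fun n hn => by simp [hn])
      exact h
  faithful := by
    intro x hx
    have h1 : (x : K →L[ℂ] K) Ω = 0 := by
      have h2 : ⟪(x : K →L[ℂ] K) Ω, (x : K →L[ℂ] K) Ω⟫_ℂ = 0 := by
        rw [← adjoint_inner_right]
        exact hx
      exact inner_self_eq_zero.1 h2
    -- Vectors mΩ with m in the commutant are dense, and x m Ω = m x Ω = 0.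
    ext ζ
    refine (closure_minimal ?_ (isClosed_singleton (x := (0 : K)).preimage
      (x : K →L[ℂ] K).continuous) (hd ζ) : (x : K →L[ℂ] K) ζ ∈ ({0} : Set K))
    rintro _ ⟨n, ⟨-, m, hm, h2, -⟩, rfl⟩
    have h3 := VonNeumannAlgebra.mem_commutant_iff.1 hm _ x.2
    change (x : K →L[ℂ] K) (n Ω) ∈ ({0} : Set K)
    rw [← h2, ← mul_apply_eq_comp, h3, mul_apply_eq_comp, h1, map_zero]
    rfl
  trace := by
    intro x y
    have h := inner_star_comm hd x.2 y.2
    rw [star_eq_adjoint, star_eq_adjoint, adjoint_inner_left, adjoint_inner_left] at h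
    exact h

end Trace

/-! ### Families of isometries indexed by a real Hilbert space -/

section Creation

variable {H : Type*} [NormedAddCommGroup H] [InnerProductSpace ℝ H] {L : H → K →L[ℂ] K}

theorem inner_family (hL : ∀ e f, adjoint (L e) * L f = (⟪e, f⟫_ℝ : ℂ) • 1) (e f : H) (x y : K) :
    ⟪L e x, L f y⟫_ℂ = (⟪e, f⟫_ℝ : ℂ) * ⟪x, y⟫_ℂ := by
  rw [← adjoint_inner_right, ← mul_apply_eq_comp, hL]
  simp

/-- A Bessel inequality for almost orthogonal ranges. With S the sum and w = ∑ L(e_i) L(e_i)* x,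
Cauchy–Schwarz gives S ≤ ‖x‖ ‖w‖, while expanding the square gives ‖w‖² ≤ (c² + Nε) S; one factor S
cancels. -/
theorem sum_norm_sq_adjoint_le (hL : ∀ e f, adjoint (L e) * L f = (⟪e, f⟫_ℝ : ℂ) • 1)
    (e : ℕ → H) (N : ℕ) (c ε : ℝ) (hε : 0 ≤ ε) (hc : ∀ i, ‖e i‖ = c)
    (h : ∀ i j, i ≠ j → |⟪e i, e j⟫_ℝ| ≤ ε) (x : K) :
    ∑ i ∈ Finset.range N, ‖adjoint (L (e i)) x‖ ^ 2 ≤ (c ^ 2 + N * ε) * ‖x‖ ^ 2 := by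
  set z : ℕ → K := fun i => adjoint (L (e i)) x with hz
  set S : ℝ := ∑ i ∈ Finset.range N, ‖z i‖ ^ 2 with hS
  set w : K := ∑ i ∈ Finset.range N, L (e i) (z i) with hw
  have hS0 : 0 ≤ S := Finset.sum_nonneg fun _ _ => sq_nonneg _
  have h1 : S ≤ ‖x‖ * ‖w‖ := by
    have h2 : ⟪x, w⟫_ℂ = (S : ℂ) := by
      rw [hw, inner_sum, hS]
      push_cast
      refine Finset.sum_congr rfl fun i _ => ?_
      rw [← adjoint_inner_left, inner_self_eq_norm_sq_to_K]
      rfl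
    have h3 := norm_inner_le_norm (𝕜 := ℂ) x w
    rw [h2, Complex.norm_real] at h3
    exact (le_abs_self S).trans h3
  have h2 : ‖w‖ ^ 2 ≤ (c ^ 2 + N * ε) * S := by
    have h3 : ‖w‖ ^ 2 = ∑ i ∈ Finset.range N, ∑ j ∈ Finset.range N,
        (⟪e i, e j⟫_ℝ * (⟪z i, z j⟫_ℂ).re) := by
      rw [← inner_self_eq_norm_sq (𝕜 := ℂ), hw, sum_inner]
      simp only [inner_sum, inner_family hL, map_sum]
      refine Finset.sum_congr rfl fun i _ => Finset.sum_congr rfl fun j _ => ?_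
      simp
    rw [h3]
    have h4 : ∀ i j, ⟪e i, e j⟫_ℝ * (⟪z i, z j⟫_ℂ).re ≤
        (if i = j then c ^ 2 * ‖z i‖ ^ 2 else 0) + ε * (‖z i‖ * ‖z j‖) := by
      intro i j
      have h5 : |(⟪z i, z j⟫_ℂ).re| ≤ ‖z i‖ * ‖z j‖ :=
        (Complex.abs_re_le_norm _).trans (norm_inner_le_norm _ _)
      by_cases hij : i = j
      · subst hij
        have h6 : (⟪z i, z i⟫_ℂ).re = ‖z i‖ ^ 2 := inner_self_eq_norm_sq (𝕜 := ℂ) _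
        rw [if_pos rfl, real_inner_self_eq_norm_sq, hc, h6]
        have : 0 ≤ ε * (‖z i‖ * ‖z i‖) := by positivity
        linarith
      · rw [if_neg hij, zero_add]
        refine (le_abs_self _).trans ?_
        rw [abs_mul]
        exact mul_le_mul (h i j hij) h5 (abs_nonneg _) hε
    refine (Finset.sum_le_sum fun i _ => Finset.sum_le_sum fun j _ => h4 i j).trans ?_
    have h7 : ∑ i ∈ Finset.range N, ∑ j ∈ Finset.range N,
        ((if i = j then c ^ 2 * ‖z i‖ ^ 2 else 0) + ε * (‖z i‖ * ‖z j‖)) =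
        c ^ 2 * S + ε * (∑ i ∈ Finset.range N, ‖z i‖) ^ 2 := by
      simp only [Finset.sum_add_distrib, Finset.sum_ite_eq]
      rw [sq (∑ i ∈ Finset.range N, ‖z i‖), Finset.sum_mul_sum, hS, Finset.mul_sum,
        Finset.mul_sum]
      congr 1
      · exact Finset.sum_congr rfl fun i hi => if_pos hi
      · exact Finset.sum_congr rfl fun i _ => (Finset.mul_sum _ _ _).symm
    rw [h7]
    -- The off-diagonal terms contribute at most ε (∑ ‖z_i‖)² ≤ ε N S.
    have h8 := sq_sum_le_card_mul_sum_sq (s := Finset.range N) (f := fun i => ‖z i‖)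
    rw [Finset.card_range] at h8
    have h9 := mul_le_mul_of_nonneg_left h8 hε
    linarith
  have h3 : S ^ 2 ≤ ‖x‖ ^ 2 * ((c ^ 2 + N * ε) * S) := by
    calc S ^ 2 ≤ (‖x‖ * ‖w‖) ^ 2 := pow_le_pow_left₀ hS0 h1 2
      _ = ‖x‖ ^ 2 * ‖w‖ ^ 2 := mul_pow _ _ _
      _ ≤ _ := mul_le_mul_of_nonneg_left h2 (sq_nonneg _)
  rcases hS0.eq_or_lt with h0 | h0
  · rw [← h0]; positivity
  · refine le_of_mul_le_mul_right ?_ h0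
    linarith

/-- Bounded sequences which are asymptotically invariant under a mixing representation are
asymptotically annihilated by the adjoints of the creation operators. -/
theorem tendsto_adjoint_of_mixing {G : Type*} [Group G] [Infinite G] {π : G →* (H ≃ₗᵢ[ℝ] H)}
    (hπ : IsMixing π) (hL : ∀ e f, adjoint (L e) * L f = (⟪e, f⟫_ℝ : ℂ) • 1)
    (V : G → K →L[ℂ] K) (hV : ∀ g x, ‖V g x‖ = ‖x‖)
    (hVL : ∀ g e, adjoint (L e) * V g = V g * adjoint (L (π g e)))
    {l : Filter ℕ} {ξ : ℕ → K} {C : ℝ} (hC : ∀ n, ‖ξ n‖ ≤ C)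
    (hξ : ∀ g, Tendsto (fun n => V g (ξ n) - ξ n) l (𝓝 0)) (e : H) :
    Tendsto (fun n => adjoint (L e) (ξ n)) l (𝓝 0) := by
  rw [Metric.tendsto_nhds]
  intro ε hε
  -- B bounds the Bessel sums for every N once the pairwise inner products are at most 1/N, as then
  -- c² + N · (1/N) = ‖e‖² + 1. N is chosen so that N terms of size (ε/2)² exceed B.
  set B : ℝ := (‖e‖ ^ 2 + 1) * C ^ 2 with hB
  obtain ⟨N, hN⟩ := exists_nat_gt (B / (ε / 2) ^ 2)
  have hN0 : (0 : ℝ) < N := lt_of_le_of_lt (by positivity) hN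
  have : Std.Symm fun a b : G => |⟪π a e, π b e⟫_ℝ| ≤ 1 / N :=
    ⟨fun a b h => by rwa [real_inner_comm]⟩
  -- Greedy choice: by mixing, all but finitely many b make π(b)e almost orthogonal to the finitely
  -- many earlier translates, and G is infinite.
  obtain ⟨g, -, hg⟩ := exists_seq_of_forall_finset_exists' (α := G) (fun _ => True)
    (fun a b => |⟪π a e, π b e⟫_ℝ| ≤ 1 / N)
    (by
      intro s _
      have h1 : ∀ᶠ b in cofinite, ∀ a ∈ s, |⟪π a e, π b e⟫_ℝ| < 1 / N := by
        rw [Finset.eventually_all]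
        intro a _
        have h2 := hπ e (π a e)
        have h3 := (Metric.tendsto_nhds.1 h2) (1 / N) (by positivity)
        refine h3.mono fun b hb => ?_
        rwa [Real.dist_0_eq_abs, real_inner_comm] at hb
      obtain ⟨b, hb⟩ := h1.exists
      exact ⟨b, trivial, fun a ha => (hb a ha).le⟩)
  have hsum : ∀ n, ∑ i ∈ Finset.range N, ‖adjoint (L (π (g i) e)) (ξ n)‖ ^ 2 ≤ B := by
    intro n
    refine (sum_norm_sq_adjoint_le hL (fun i => π (g i) e) N ‖e‖ (1 / N) (by positivity)
      (fun i => LinearIsometryEquiv.norm_map _ _) (fun i j hij => hg hij) (ξ n)).trans ?_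
    rw [mul_one_div_cancel hN0.ne', hB]
    exact mul_le_mul_of_nonneg_left (pow_le_pow_left₀ (norm_nonneg _) (hC n) 2) (by positivity)
  have hev : ∀ᶠ n in l, ∀ i ∈ Finset.range N,
      ‖adjoint (L e) (V (g i) (ξ n) - ξ n)‖ < ε / 2 := by
    rw [Finset.eventually_all]
    intro i _
    have h1 := ((adjoint (L e)).continuous.tendsto 0).comp (hξ (g i))
    rw [map_zero] at h1
    refine ((Metric.tendsto_nhds.1 h1) (ε / 2) (by positivity)).mono fun n hn => ?_
    rwa [dist_zero_right] at hn
  refine hev.mono fun n hn => ?_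
  rw [dist_zero_right]
  by_contra! hlt
  -- If L(e)*ξ_n had norm at least ε, near invariance under each g_i would force norm at least ε/2
  -- for every L(π(g_i)e)*ξ_n, against the choice of N.
  have h1 : ∀ i ∈ Finset.range N, (ε / 2) ^ 2 ≤ ‖adjoint (L (π (g i) e)) (ξ n)‖ ^ 2 := by
    intro i hi
    refine pow_le_pow_left₀ (by positivity) ?_ 2
    have h2 : ‖adjoint (L e) (V (g i) (ξ n))‖ = ‖adjoint (L (π (g i) e)) (ξ n)‖ := by
      rw [← mul_apply_eq_comp, hVL, mul_apply_eq_comp, hV]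
    have h3 := hn i hi
    rw [map_sub] at h3
    have h4 := norm_sub_norm_le (adjoint (L e) (ξ n)) (adjoint (L e) (V (g i) (ξ n)))
    rw [norm_sub_rev] at h4
    linarith
  have h2 := (Finset.sum_le_sum h1).trans (hsum n)
  rw [Finset.sum_const, Finset.card_range, nsmul_eq_mul] at h2
  rw [div_lt_iff₀ (by positivity)] at hN
  linarith

/-- The Wick product of a list of vectors: the operator polynomial in the operators `L(e) + L(e)*`
which maps the vacuum to the corresponding elementary tensor. -/
def wick (L : H → K →L[ℂ] K) : List H → (K →L[ℂ] K)
  | [] => 1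
  | [e] => L e + adjoint (L e)
  | e :: f :: v => (L e + adjoint (L e)) * wick L (f :: v) - (⟪e, f⟫_ℝ : ℂ) • wick L v

theorem wick_mem {A : Subalgebra ℂ (K →L[ℂ] K)} (h : ∀ e, L e + adjoint (L e) ∈ A) (v : List H) :
    wick L v ∈ A := by
  induction v using wick.induct with
  | case1 => exact one_mem A
  | case2 e => exact h e
  | case3 e f v h1 h2 => exact sub_mem (mul_mem (h e) h1) (A.smul_mem h2 _)

/-- Each L(e)* in the recursion meets either ξ_n, where it is negligible, or some L(f), where it
produces exactly the multiple of ⟪e, f⟫ that the recursion subtracts. -/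
theorem tendsto_wick_sub (hL : ∀ e f, adjoint (L e) * L f = (⟪e, f⟫_ℝ : ℂ) • 1) {l : Filter ℕ}
    {ξ : ℕ → K} (hξ : ∀ e, Tendsto (fun n => adjoint (L e) (ξ n)) l (𝓝 0)) (v : List H) :
    Tendsto (fun n => wick L v (ξ n) - (v.map L).prod (ξ n)) l (𝓝 0) := by
  induction v using wick.induct with
  | case1 => simp [wick, tendsto_const_nhds]
  | case2 e => simpa [wick] using hξ e
  | case3 e f v h1 h2 =>
    have h3 : ∀ n, wick L (e :: f :: v) (ξ n) - ((e :: f :: v).map L).prod (ξ n) =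
        (L e + adjoint (L e)) (wick L (f :: v) (ξ n) - ((f :: v).map L).prod (ξ n)) -
          (⟪e, f⟫_ℝ : ℂ) • (wick L v (ξ n) - (v.map L).prod (ξ n)) := by
      intro n
      have h4 : adjoint (L e) (L f ((v.map L).prod (ξ n))) =
          (⟪e, f⟫_ℝ : ℂ) • (v.map L).prod (ξ n) := by
        rw [← mul_apply_eq_comp, hL]
        rfl
      simp only [wick, List.map_cons, List.prod_cons, sub_apply, mul_apply_eq_comp, smul_apply,
        map_sub, add_apply, h4, smul_sub]
      abel
    simp only [h3]
    have h4 := ((L e + adjoint (L e)).continuous.tendsto 0).comp h1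
    rw [map_zero] at h4
    simpa using h4.sub (h2.const_smul (⟪e, f⟫_ℝ : ℂ))

/-- The asymptotic version for a constant sequence. -/
theorem wick_apply_eq (hL : ∀ e f, adjoint (L e) * L f = (⟪e, f⟫_ℝ : ℂ) • 1) {x : K}
    (hx : ∀ e, adjoint (L e) x = 0) (v : List H) : wick L v x = (v.map L).prod x := by
  have h := tendsto_wick_sub hL (l := atTop) (ξ := fun _ => x)
    (fun e => by simp [hx]) v
  exact sub_eq_zero.1 (tendsto_nhds_unique tendsto_const_nhds h)

end Creation

end Abstract

/-! ### Operators on `F ⊗ ℓ²(G)` -/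

section Tensor

variable {G : Type*} {F : Type*} [NormedAddCommGroup F] [InnerProductSpace ℂ F]

theorem ext_lp {S T : lp (fun _ : G => F) 2 →L[ℂ] lp (fun _ : G => F) 2}
    (h : ∀ ξ k, S ξ k = T ξ k) : S = T :=
  ContinuousLinearMap.ext fun ξ => lp.ext (funext (h ξ))

theorem norm_sq_diag_le {T : G → F →L[ℂ] F} {C : ℝ} (hT : ∀ k, ‖T k‖ ≤ C)
    (ξ : lp (fun _ : G => F) 2) (k : G) : ‖T k (ξ k)‖ ^ 2 ≤ C ^ 2 * ‖ξ k‖ ^ 2 := by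
  rw [← mul_pow]
  refine pow_le_pow_left₀ (norm_nonneg _) (((T k).le_opNorm _).trans ?_) 2
  exact mul_le_mul_of_nonneg_right (hT k) (norm_nonneg _)

theorem memℓp_diag {T : G → F →L[ℂ] F} {C : ℝ} (hT : ∀ k, ‖T k‖ ≤ C)
    (ξ : lp (fun _ : G => F) 2) : Memℓp (fun k => T k (ξ k)) 2 := by
  refine memℓp_gen ?_
  simpa using Summable.of_nonneg_of_le (fun _ => sq_nonneg _) (norm_sq_diag_le hT ξ)
    ((hasSum_norm_sq ξ).summable.mul_left (C ^ 2))

/-- The linear map underlying `diagOp`. -/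
def diagOpₗ (T : G → F →L[ℂ] F) (C : ℝ) (hT : ∀ k, ‖T k‖ ≤ C) :
    lp (fun _ : G => F) 2 →ₗ[ℂ] lp (fun _ : G => F) 2 where
  toFun ξ := ⟨fun k => T k (ξ k), memℓp_diag hT ξ⟩
  map_add' ξ η := lp.ext (funext fun k => map_add (T k) (ξ k) (η k))
  map_smul' c ξ := lp.ext (funext fun k => map_smul (T k) c (ξ k))

theorem norm_diagOpₗ_le (T : G → F →L[ℂ] F) (C : ℝ) (hT : ∀ k, ‖T k‖ ≤ C)
    (ξ : lp (fun _ : G => F) 2) : ‖diagOpₗ T C hT ξ‖ ≤ |C| * ‖ξ‖ := by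
  refine (pow_le_pow_iff_left₀ (norm_nonneg _) (by positivity) two_ne_zero).1 ?_
  rw [mul_pow, sq_abs]
  exact hasSum_le (norm_sq_diag_le hT ξ) (hasSum_norm_sq (diagOpₗ T C hT ξ))
    ((hasSum_norm_sq ξ).mul_left _)

/-- The block diagonal operator with the uniformly bounded blocks `T k`. -/
def diagOp (T : G → F →L[ℂ] F) (C : ℝ) (hT : ∀ k, ‖T k‖ ≤ C) :
    lp (fun _ : G => F) 2 →L[ℂ] lp (fun _ : G => F) 2 :=
  (diagOpₗ T C hT).mkContinuous |C| (norm_diagOpₗ_le T C hT)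

theorem diagOp_apply (T : G → F →L[ℂ] F) (C : ℝ) (hT : ∀ k, ‖T k‖ ≤ C)
    (ξ : lp (fun _ : G => F) 2) (k : G) : diagOp T C hT ξ k = T k (ξ k) := rfl

theorem adjoint_diagOp [CompleteSpace F] (T : G → F →L[ℂ] F) (C : ℝ) (hT : ∀ k, ‖T k‖ ≤ C) :
    adjoint (diagOp T C hT) = diagOp (fun k => adjoint (T k)) C
      (fun k => by rw [LinearIsometryEquiv.norm_map]; exact hT k) := by
  refine ((eq_adjoint_iff _ _).2 fun x y => ?_).symm
  rw [lp.inner_eq_tsum, lp.inner_eq_tsum]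
  exact tsum_congr fun k => adjoint_inner_left _ _ _

open Classical in
/-- The vector `x ⊗ δ_g`. -/
def deltaVec (g : G) : F →L[ℂ] lp (fun _ : G => F) 2 :=
  lp.singleContinuousLinearMap ℂ (fun _ : G => F) 2 g

open Classical in
theorem deltaVec_apply (g : G) (x : F) (k : G) : deltaVec g x k = if k = g then x else 0 := by
  change lp.single (E := fun _ : G => F) 2 g x k = _
  rw [lp.single_apply]
  split_ifs with h
  · subst h; simp
  · simp [h]

theorem inner_deltaVec_left (g : G) (x : F) (ξ : lp (fun _ : G => F) 2) :
    ⟪deltaVec g x, ξ⟫_ℂ = ⟪x, ξ g⟫_ℂ := by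
  classical
  exact lp.inner_single_left (𝕜 := ℂ) (G := fun _ : G => F) g x ξ

theorem norm_deltaVec (g : G) (x : F) : ‖deltaVec g x‖ = ‖x‖ := by
  classical
  exact lp.norm_single (E := fun _ : G => F) (p := 2) (by norm_num) g x

theorem diagOp_deltaVec (T : G → F →L[ℂ] F) (C : ℝ) (hT : ∀ k, ‖T k‖ ≤ C) (g : G) (x : F) :
    diagOp T C hT (deltaVec g x) = deltaVec g (T g x) := by
  refine lp.ext (funext fun k => ?_)
  rw [diagOp_apply, deltaVec_apply, deltaVec_apply]
  split_ifs with h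
  · rw [h]
  · exact map_zero _

/-- If the vectors `x ⊗ δ_g` with `x` in a set with dense span lie in a closed subspace, then the
subspace is everything. -/
theorem mem_of_deltaVec_mem {s : Set F} (hs : Dense (Submodule.span ℂ s : Set F))
    {S : Submodule ℂ (lp (fun _ : G => F) 2)} (hS : IsClosed (S : Set (lp (fun _ : G => F) 2)))
    (h : ∀ g, ∀ x ∈ s, deltaVec g x ∈ S) (ξ : lp (fun _ : G => F) 2) : ξ ∈ S := by
  classical
  have h1 : ∀ g x, deltaVec g x ∈ S := fun g x =>
    mem_of_dense_span hs (S := S.comap (deltaVec g : F →L[ℂ] lp (fun _ : G => F) 2).toLinearMap)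
      (hS.preimage (deltaVec g : F →L[ℂ] lp (fun _ : G => F) 2).continuous) (h g) x
  have h2 := lp.hasSum_single (E := fun _ : G => F) (p := 2) (by norm_num) ξ
  exact hS.mem_of_tendsto h2 (Eventually.of_forall fun t => S.sum_mem fun g _ => h1 g (ξ g))

theorem dense_span_deltaVec {s : Set F} (hs : Dense (Submodule.span ℂ s : Set F)) :
    Dense (Submodule.span ℂ {ξ | ∃ g : G, ∃ x ∈ s, ξ = deltaVec g x} :
      Set (lp (fun _ : G => F) 2)) := by
  intro ξ
  have h := mem_of_deltaVec_mem hs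
    (S := (Submodule.span ℂ {ξ | ∃ g : G, ∃ x ∈ s, ξ = deltaVec g x}).topologicalClosure)
    (Submodule.isClosed_topologicalClosure _)
    (fun g x hx => Submodule.le_topologicalClosure _ (Submodule.subset_span ⟨g, x, hx, rfl⟩)) ξ
  exact h

theorem eq_of_inner_deltaVec {E : Type*} [NormedAddCommGroup E] [InnerProductSpace ℂ E]
    {ξ η : lp (fun _ : G => Fock E) 2}
    (h : ∀ g v, ⟪deltaVec g (Fock.word v), ξ⟫_ℂ = ⟪deltaVec g (Fock.word v), η⟫_ℂ) : ξ = η :=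
  lp.ext (funext fun g => Fock.eq_of_inner_words fun v => by
    simpa only [inner_deltaVec_left] using h g v)

variable [Group G]

theorem tensorShift_deltaVec (T : F →L[ℂ] F) (g h : G) (x : F) :
    tensorShift T g (deltaVec h x) = deltaVec (g * h) (T x) := by
  refine lp.ext (funext fun k => ?_)
  rw [tensorShift_apply, deltaVec_apply, deltaVec_apply]
  by_cases hk : k = g * h
  · rw [if_pos hk, if_pos (by rw [hk, inv_mul_cancel_left])]
  · rw [if_neg hk, if_neg (fun h1 => hk (by rw [← h1, mul_inv_cancel_left])), map_zero]

theorem tensorShift_mul (S T : F →L[ℂ] F) (g h : G) :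
    tensorShift S g * tensorShift T h = tensorShift (S * T) (g * h) := by
  refine ext_lp fun ξ k => ?_
  rw [mul_apply_eq_comp, tensorShift_apply, tensorShift_apply, tensorShift_apply, mul_inv_rev,
    mul_assoc]
  rfl

theorem tensorShift_one_one : tensorShift (1 : F →L[ℂ] F) (1 : G) = 1 := by
  refine ext_lp fun ξ k => ?_
  rw [tensorShift_apply, inv_one, one_mul]
  rfl

theorem tensorShift_add (S T : F →L[ℂ] F) (g : G) :
    tensorShift (S + T) g = tensorShift S g + tensorShift T g := rfl

theorem tensorShift_smul (c : ℂ) (T : F →L[ℂ] F) (g : G) :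
    tensorShift (c • T) g = c • tensorShift T g := rfl

theorem tensorShift_zero (g : G) : tensorShift (0 : F →L[ℂ] F) g = 0 := rfl

theorem adjoint_tensorShift [CompleteSpace F] (T : F →L[ℂ] F) (g : G) :
    adjoint (tensorShift T g) = tensorShift (adjoint T) g⁻¹ := by
  refine ((eq_adjoint_iff _ _).2 fun x y => ?_).symm
  rw [lp.inner_eq_tsum, lp.inner_eq_tsum]
  refine (Equiv.tsum_eq (Equiv.mulLeft g⁻¹) _).symm.trans (tsum_congr fun k => ?_)
  simp only [Equiv.coe_mulLeft, tensorShift_apply, inv_inv, mul_inv_cancel_left]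
  exact adjoint_inner_left _ _ _

end Tensor

/-! ### The crossed product and its commutant -/

section Crossed

variable {G : Type*} [Group G] {H : Type*} [NormedAddCommGroup H] [InnerProductSpace ℝ H]

local notation "F" => Fock (Complexification H)
local notation "K" => lp (fun _ : G => Fock (Complexification H)) 2

open Complexification (ofReal)

/-- The vacuum vector `Ω ⊗ δ_1` of the crossed product. -/
def vac (G H : Type*) [Group G] [NormedAddCommGroup H] [InnerProductSpace ℝ H] :
    lp (fun _ : G => Fock (Complexification H)) 2 :=
  deltaVec 1 (Fock.vacuum (Complexification H))

theorem norm_vac : ‖vac G H‖ = 1 := by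
  rw [vac, norm_deltaVec, Fock.norm_vacuum]

variable (G) in
/-- The operator `ℓ(e) ⊗ 1`. -/
def leftOp (e : H) : K →L[ℂ] K := tensorShift (Fock.creation (ofReal e)) 1

/-- The creation operators for the right multiplication of the crossed product. -/
def rightOp (π : G →* (H ≃ₗᵢ[ℝ] H)) (e : H) : K →L[ℂ] K :=
  diagOp (fun k => Fock.rightCreation (ofReal (π k e))) ‖e‖ fun k => by
    refine (Fock.norm_rightCreation_le _).trans ?_
    rw [norm_ofReal, LinearIsometryEquiv.norm_map]

/-- The unitary `u_g` of the crossed product. -/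
def unit (π : G →* (H ≃ₗᵢ[ℝ] H)) (g : G) : K →L[ℂ] K := tensorShift (koopman π g) g

variable (H) in
/-- The operator `1 ⊗ λ_g`. -/
def shift (g : G) : K →L[ℂ] K := tensorShift 1 g

variable (π : G →* (H ≃ₗᵢ[ℝ] H))

theorem adjoint_leftOp_mul_leftOp (e f : H) :
    adjoint (leftOp G e) * leftOp G f = (⟪e, f⟫_ℝ : ℂ) • 1 := by
  rw [leftOp, leftOp, adjoint_tensorShift, tensorShift_mul, Fock.adjoint_creation_mul_creation,
    inner_ofReal, inv_one, one_mul, tensorShift_smul, tensorShift_one_one]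

theorem adjoint_rightOp_apply (e : H) (ξ : K) (k : G) :
    adjoint (rightOp π e) ξ k = adjoint (Fock.rightCreation (ofReal (π k e))) (ξ k) := by
  rw [rightOp, adjoint_diagOp, diagOp_apply]

theorem adjoint_rightOp_mul_rightOp (e f : H) :
    adjoint (rightOp π e) * rightOp π f = (⟪e, f⟫_ℝ : ℂ) • 1 := by
  refine ext_lp fun ξ k => ?_
  rw [mul_apply_eq_comp, adjoint_rightOp_apply, rightOp, diagOp_apply, ← mul_apply_eq_comp,
    Fock.adjoint_rightCreation_mul_rightCreation, inner_ofReal, LinearIsometryEquiv.inner_map_map]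
  rfl

theorem adjoint_leftOp_deltaVec_vacuum (e : H) (g : G) :
    adjoint (leftOp G e) (deltaVec g (Fock.vacuum _)) = 0 := by
  rw [leftOp, adjoint_tensorShift, tensorShift_deltaVec, Fock.adjoint_creation_vacuum, map_zero]

theorem adjoint_rightOp_vac (e : H) : adjoint (rightOp π e) (vac G H) = 0 := by
  rw [rightOp, adjoint_diagOp, vac, diagOp_deltaVec, Fock.adjoint_rightCreation_vacuum, map_zero]

theorem leftOp_prod_apply (v : List H) (g : G) :
    (v.map (leftOp G)).prod (deltaVec g (Fock.vacuum _)) = deltaVec g (realWord v) := by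
  induction v with
  | nil => rfl
  | cons e v ih =>
    rw [List.map_cons, List.prod_cons, mul_apply_eq_comp, ih, leftOp, tensorShift_deltaVec, one_mul,
      realWord, Fock.creation_word]
    rfl

/-- The innermost right creation operator acts first, so letters accumulate in reverse order; in
coordinate 1 the twist is trivial. -/
theorem rightOp_prod_apply (v : List H) :
    (v.map (rightOp π)).prod (vac G H) = deltaVec 1 (realWord v.reverse) := by
  induction v with
  | nil => rfl
  | cons e v ih =>
    rw [List.map_cons, List.prod_cons, mul_apply_eq_comp, ih, rightOp, diagOp_deltaVec,
      realWord, Fock.rightCreation_word, map_one]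
    simp [realWord]

theorem wick_leftOp_apply (v : List H) (g : G) :
    wick (leftOp G) v (deltaVec g (Fock.vacuum _)) = deltaVec g (realWord v) := by
  rw [wick_apply_eq adjoint_leftOp_mul_leftOp (fun e => adjoint_leftOp_deltaVec_vacuum e g),
    leftOp_prod_apply]

theorem wick_rightOp_apply (v : List H) :
    wick (rightOp π) v (vac G H) = deltaVec 1 (realWord v.reverse) := by
  rw [wick_apply_eq (adjoint_rightOp_mul_rightOp π) (adjoint_rightOp_vac π), rightOp_prod_apply]

theorem unit_vac (g : G) : unit π g (vac G H) = deltaVec g (Fock.vacuum _) := by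
  rw [unit, vac, tensorShift_deltaVec, koopman_vacuum, mul_one]

theorem shift_vac (g : G) : shift H g (vac G H) = deltaVec g (Fock.vacuum _) := by
  rw [shift, vac, tensorShift_deltaVec, mul_one]
  rfl

theorem star_unit (g : G) : star (unit π g) = unit π g⁻¹ := by
  rw [star_eq_adjoint, unit, adjoint_tensorShift, adjoint_koopman]
  rfl

theorem star_shift (g : G) : star (shift H g) = shift H g⁻¹ := by
  rw [star_eq_adjoint, shift, adjoint_tensorShift, ← star_eq_adjoint, star_one]
  rfl

theorem unit_mul (g h : G) : unit π g * unit π h = unit π (g * h) := by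
  rw [unit, unit, unit, tensorShift_mul, koopman_mul]

theorem unit_one : unit π 1 = 1 := by
  rw [unit, koopman_one, tensorShift_one_one]

theorem leftOp_add_adjoint (e : H) :
    leftOp G e + adjoint (leftOp G e) = tensorShift (semicircular e) 1 := by
  rw [leftOp, adjoint_tensorShift, inv_one, semicircular, tensorShift_add]

theorem rightOp_add_adjoint_apply (e : H) (ξ : K) (k : G) :
    (rightOp π e + adjoint (rightOp π e)) ξ k = rightSemicircular (π k e) (ξ k) := by
  rw [add_apply, lp.coeFn_add, Pi.add_apply, adjoint_rightOp_apply]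
  rfl

theorem adjoint_creation_mul_koopman (g : G) (e : H) :
    adjoint (Fock.creation (ofReal (π g e))) * koopman π g =
      koopman π g * adjoint (Fock.creation (ofReal e)) := by
  have h := congrArg adjoint (koopman_mul_creation π g⁻¹ (π g e))
  have h1 : π g⁻¹ (π g e) = e := by
    rw [map_inv]
    exact LinearIsometryEquiv.symm_apply_apply (π g) e
  rw [h1] at h
  simp only [← star_eq_adjoint, star_mul] at h
  simpa only [star_eq_adjoint, adjoint_koopman, inv_inv] using h

theorem adjoint_rightCreation_mul_koopman (g : G) (e : H) :
    adjoint (Fock.rightCreation (ofReal (π g e))) * koopman π g =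
      koopman π g * adjoint (Fock.rightCreation (ofReal e)) := by
  have h := congrArg adjoint (koopman_mul_rightCreation π g⁻¹ (π g e))
  have h1 : π g⁻¹ (π g e) = e := by
    rw [map_inv]
    exact LinearIsometryEquiv.symm_apply_apply (π g) e
  rw [h1] at h
  simp only [← star_eq_adjoint, star_mul] at h
  simpa only [star_eq_adjoint, adjoint_koopman, inv_inv] using h

theorem koopman_mul_rightSemicircular (g : G) (e : H) :
    koopman π g * rightSemicircular e = rightSemicircular (π g e) * koopman π g := by
  rw [rightSemicircular, rightSemicircular, mul_add, add_mul, koopman_mul_rightCreation,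
    adjoint_rightCreation_mul_koopman]

theorem apply_apply_inv_mul (g k : G) (e : H) : π g (π (g⁻¹ * k) e) = π k e := by
  have h : π g * π (g⁻¹ * k) = π k := by rw [← map_mul, mul_inv_cancel_left]
  exact congrArg (fun U : H ≃ₗᵢ[ℝ] H => U e) h

theorem unit_mem (g : G) : unit π g ∈ bogoljubovGroupAlgebra π :=
  subset_generated (Set.mem_range_self g)

theorem unit_mem_crossedProduct (g : G) : unit π g ∈ bogoljubovCrossedProduct π :=
  groupAlgebra_le _ _ (unit_mem π g)

theorem semicircular_mem (e : H) :
    leftOp G e + adjoint (leftOp G e) ∈ bogoljubovCrossedProduct π := by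
  rw [leftOp_add_adjoint]
  exact subset_generated (Or.inl ⟨_, subset_generated (Set.mem_range_self e), rfl⟩)

theorem mem_commutant_crossedProduct {y : K →L[ℂ] K}
    (h1 : ∀ a ∈ freeGaussian H, tensorShift a 1 * y = y * tensorShift a 1)
    (h2 : ∀ g, unit π g * y = y * unit π g) : y ∈ (bogoljubovCrossedProduct π).commutant := by
  refine mem_commutant_generated ?_
  rintro _ (⟨a, ha, rfl⟩ | ⟨g, rfl⟩)
  · refine ⟨h1 a ha, ?_⟩
    rw [star_eq_adjoint, adjoint_tensorShift, inv_one]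
    exact h1 _ (star_mem ha)
  · refine ⟨h2 g, ?_⟩
    change star (unit π g) * y = y * star (unit π g)
    rw [star_unit, h2]

/-- Each block is a right semicircular operator and commutes with Γ(H)''. The twist by π(k) gives
compatibility with u_g: moving coordinate g⁻¹k to k, ℱ(π(g)) turns the letter π(g⁻¹k)e into π(k)e.
-/
theorem rightSemicircular_mem_commutant (e : H) :
    rightOp π e + adjoint (rightOp π e) ∈ (bogoljubovCrossedProduct π).commutant := by
  refine mem_commutant_crossedProduct π (fun a ha => ext_lp fun ξ k => ?_)
    fun g => ext_lp fun ξ k => ?_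
  · rw [mul_apply_eq_comp, mul_apply_eq_comp, tensorShift_apply, rightOp_add_adjoint_apply,
      rightOp_add_adjoint_apply, tensorShift_apply, inv_one, one_mul, ← mul_apply_eq_comp,
      ← mul_comm_rightSemicircular ha]
    rfl
  · rw [mul_apply_eq_comp, mul_apply_eq_comp, unit, tensorShift_apply, rightOp_add_adjoint_apply,
      rightOp_add_adjoint_apply, tensorShift_apply, ← mul_apply_eq_comp,
      koopman_mul_rightSemicircular, apply_apply_inv_mul]
    rfl

end Crossed

/-! ### Abelian groups: shifts in the commutant and the canonical trace -/

section Abelian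

variable {G : Type*} [CommGroup G] {H : Type*} [NormedAddCommGroup H] [InnerProductSpace ℝ H]
  (π : G →* (H ≃ₗᵢ[ℝ] H))

local notation "F" => Fock (Complexification H)
local notation "K" => lp (fun _ : G => Fock (Complexification H)) 2

open Complexification (ofReal)

/-- Commutativity of G enters here: λ_g commutes with every λ_h, so left translations implement
right multiplication by u_g. -/
theorem shift_mem_commutant (g : G) : shift H g ∈ (bogoljubovCrossedProduct π).commutant := by
  refine mem_commutant_crossedProduct π (fun a _ => ?_) fun h => ?_
  · rw [shift, tensorShift_mul, tensorShift_mul, one_mul, mul_one, one_mul, mul_one]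
  · rw [unit, shift, tensorShift_mul, tensorShift_mul, one_mul, mul_one, mul_comm]

/-- The left and right semicircular operators are self-adjoint and both send `vac` to e ⊗ δ_1. -/
theorem semicircular_implemented (e : H) : leftOp G e + adjoint (leftOp G e) ∈
    implementedAlgebra (bogoljubovCrossedProduct π) (vac G H) := by
  have h : (rightOp π e + adjoint (rightOp π e)) (vac G H) =
      (leftOp G e + adjoint (leftOp G e)) (vac G H) := by
    have h1 := wick_rightOp_apply π [e]
    have h2 := wick_leftOp_apply [e] (1 : G)
    exact h1.trans h2.symm
  refine ⟨semicircular_mem π e, _, rightSemicircular_mem_commutant π e, h, ?_⟩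
  simp only [star_add, ← star_eq_adjoint, star_star] at h ⊢
  rwa [add_comm, add_comm (star (leftOp G e))]

theorem unit_implemented (g : G) : unit π g ∈
    implementedAlgebra (bogoljubovCrossedProduct π) (vac G H) := by
  refine ⟨unit_mem_crossedProduct π g, _, shift_mem_commutant π g, ?_, ?_⟩
  · rw [unit_vac, shift_vac]
  · rw [star_unit, star_shift, unit_vac, shift_vac]

theorem wick_mul_unit_implemented (v : List H) (g : G) : wick (leftOp G) v * unit π g ∈
    implementedAlgebra (bogoljubovCrossedProduct π) (vac G H) :=
  mul_mem (wick_mem (semicircular_implemented π) v) (unit_implemented π g)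

theorem wick_mul_unit_vac (v : List H) (g : G) :
    (wick (leftOp G) v * unit π g) (vac G H) = deltaVec g (realWord v) := by
  rw [mul_apply_eq_comp, unit_vac, wick_leftOp_apply]

/-- The finite linear combinations of the elements `W(v) u_g`, applied to the vacuum vector, are
dense. -/
theorem dense_wick_mul_unit_vac (ζ : K) : ζ ∈ closure ((fun n : K →L[ℂ] K => n (vac G H)) ''
    (Submodule.span ℂ {n | ∃ (v : List H) (g : G), n = wick (leftOp G) v * unit π g})) := by
  have h := dense_span_deltaVec (G := G) (dense_span_realWord (H := H)) ζ
  refine closure_mono ?_ h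
  let φ : (K →L[ℂ] K) →ₗ[ℂ] K :=
    { toFun := fun n => n (vac G H)
      map_add' := fun _ _ => rfl
      map_smul' := fun _ _ => rfl }
  have h1 : Submodule.span ℂ {ξ : K | ∃ g : G, ∃ x ∈ Set.range realWord, ξ = deltaVec g x} ≤
      (Submodule.span ℂ {n | ∃ (v : List H) (g : G), n = wick (leftOp G) v * unit π g}).map φ := by
    refine Submodule.span_le.2 ?_
    rintro _ ⟨g, _, ⟨v, rfl⟩, rfl⟩
    exact ⟨_, Submodule.subset_span ⟨v, g, rfl⟩, wick_mul_unit_vac π v g⟩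
  exact h1

theorem span_wick_mul_unit_le :
    Submodule.span ℂ {n | ∃ (v : List H) (g : G), n = wick (leftOp G) v * unit π g} ≤
      Subalgebra.toSubmodule (implementedAlgebra (bogoljubovCrossedProduct π) (vac G H)) := by
  refine Submodule.span_le.2 ?_
  rintro _ ⟨v, g, rfl⟩
  exact wick_mul_unit_implemented π v g

theorem dense_implemented_vac (ζ : K) : ζ ∈ closure ((fun n : K →L[ℂ] K => n (vac G H)) ''
    implementedAlgebra (bogoljubovCrossedProduct π) (vac G H)) :=
  closure_mono (Set.image_mono (span_wick_mul_unit_le π)) (dense_wick_mul_unit_vac π ζ)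

theorem isFaithfulNormalTrace_canonicalTrace :
    IsFaithfulNormalTrace (bogoljubovCrossedProduct π) (canonicalTrace π) :=
  isFaithfulNormalTrace_vectorState (dense_implemented_vac π) norm_vac

end Abelian

/-! ### The conditional expectation onto the group algebra -/

section WeakLimit

variable {K : Type*} [NormedAddCommGroup K] [InnerProductSpace ℂ K] [CompleteSpace K]

/-- A bounded family of operators converges weakly along every ultrafilter. -/
theorem exists_weak_limit {ι : Type*} (𝒰 : Ultrafilter ι) {A : ι → K →L[ℂ] K} {C : ℝ}
    (hA : ∀ i, ‖A i‖ ≤ C) : ∃ z : K →L[ℂ] K, ‖z‖ ≤ C ∧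
      ∀ η ξ, Tendsto (fun i => ⟪A i η, ξ⟫_ℂ) 𝒰 (𝓝 ⟪z η, ξ⟫_ℂ) := by
  obtain ⟨i₀⟩ : Nonempty ι := 𝒰.neBot.nonempty
  have hC : 0 ≤ C := (norm_nonneg _).trans (hA i₀)
  have hbound : ∀ η ξ i, ‖⟪A i η, ξ⟫_ℂ‖ ≤ C * ‖η‖ * ‖ξ‖ := fun η ξ i =>
    (norm_inner_le_norm _ _).trans (mul_le_mul_of_nonneg_right
      (((A i).le_opNorm _).trans (mul_le_mul_of_nonneg_right (hA i) (norm_nonneg _)))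
      (norm_nonneg _))
  have hlim : ∀ η ξ, ∃ b : ℂ, Tendsto (fun i => ⟪A i η, ξ⟫_ℂ) 𝒰 (𝓝 b) := by
    intro η ξ
    obtain ⟨b, -, hb⟩ := (isCompact_closedBall (0 : ℂ) (C * ‖η‖ * ‖ξ‖)).ultrafilter_le_nhds
      (𝒰.map fun i => ⟪A i η, ξ⟫_ℂ) (by
        rw [le_principal_iff]
        refine Filter.mem_map.2 (Filter.univ_mem' fun i => ?_)
        change ⟪A i η, ξ⟫_ℂ ∈ Metric.closedBall (0 : ℂ) _
        rw [mem_closedBall_zero_iff]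
        exact hbound η ξ i)
    exact ⟨b, hb⟩
  choose b hb using hlim
  have hb_le : ∀ η ξ, ‖b η ξ‖ ≤ C * ‖η‖ * ‖ξ‖ := fun η ξ =>
    le_of_tendsto (hb η ξ).norm (Eventually.of_forall (hbound η ξ))
  -- The limits of the matrix coefficients form a bounded sesquilinear form, which an operator
  -- represents by the Riesz theorem.
  let B : K →L⋆[ℂ] K →L[ℂ] ℂ := LinearMap.mkContinuous₂
    (LinearMap.mk₂'ₛₗ (starRingEnd ℂ) (RingHom.id ℂ) b
      (fun η η' ξ => tendsto_nhds_unique (hb _ _)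
        (by simpa only [map_add, inner_add_left] using (hb η ξ).add (hb η' ξ)))
      (fun c η ξ => tendsto_nhds_unique (hb _ _)
        (by simpa only [map_smul, inner_smul_left, smul_eq_mul] using
          (hb η ξ).const_mul (starRingEnd ℂ c)))
      (fun η ξ ξ' => tendsto_nhds_unique (hb _ _)
        (by simpa only [inner_add_right] using (hb η ξ).add (hb η ξ')))
      (fun c η ξ => tendsto_nhds_unique (hb _ _)
        (by simpa only [inner_smul_right, smul_eq_mul, RingHom.id_apply] using
          (hb η ξ).const_mul c))) C hb_le
  have hB : ∀ η ξ, ⟪InnerProductSpace.continuousLinearMapOfBilin B η, ξ⟫_ℂ = b η ξ := fun η ξ =>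
    InnerProductSpace.continuousLinearMapOfBilin_apply B η ξ
  refine ⟨InnerProductSpace.continuousLinearMapOfBilin B, opNorm_le_bound _ hC fun η => ?_,
    fun η ξ => by rw [hB]; exact hb η ξ⟩
  set ζ := InnerProductSpace.continuousLinearMapOfBilin B η with hζ
  have h1 := hb_le η ζ
  rw [← hB, ← hζ, inner_self_eq_norm_sq_to_K] at h1
  by_cases h0 : ‖ζ‖ = 0
  · rw [h0]; positivity
  · have h4 : 0 < ‖ζ‖ := lt_of_le_of_ne (norm_nonneg _) (Ne.symm h0)
    refine le_of_mul_le_mul_right ?_ h4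
    rw [← sq]
    simpa using h1

end WeakLimit

section Expectation

variable {G : Type*} [CommGroup G] {H : Type*} [NormedAddCommGroup H] [InnerProductSpace ℝ H]

local notation "F" => Fock (Complexification H)
local notation "K" => lp (fun _ : G => Fock (Complexification H)) 2

variable (G H) in
/-- The projection onto `Ω ⊗ ℓ²(G)`. -/
def vacOp : K →L[ℂ] K := tensorShift (Fock.vacuumProj (Complexification H)) 1

theorem vacOp_apply (ξ : K) (k : G) : vacOp G H ξ k = Fock.vacuumProj _ (ξ k) := by
  rw [vacOp, tensorShift_apply, inv_one, one_mul]

theorem adjoint_vacOp : adjoint (vacOp G H) = vacOp G H := by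
  rw [vacOp, adjoint_tensorShift, Fock.adjoint_vacuumProj, inv_one]

theorem vacOp_mul_self : vacOp G H * vacOp G H = vacOp G H := by
  have h : Fock.vacuumProj (Complexification H) * Fock.vacuumProj _ = Fock.vacuumProj _ := by
    refine Fock.ext_words fun v => ?_
    cases v <;> simp [mul_apply_eq_comp, Fock.vacuumProj_word_nil, Fock.vacuumProj_word_cons]
  rw [vacOp, tensorShift_mul, h, one_mul]

theorem vacOp_deltaVec (g : G) (x : F) :
    vacOp G H (deltaVec g x) = deltaVec g (Fock.vacuumProj _ x) := by
  rw [vacOp, tensorShift_deltaVec, one_mul]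

theorem inner_vacOp_self (ξ : K) : ⟪vacOp G H ξ, ξ⟫_ℂ = (‖vacOp G H ξ‖ : ℂ) ^ 2 := by
  have h := inner_self_eq_norm_sq_to_K (𝕜 := ℂ) (vacOp G H ξ)
  rw [← adjoint_inner_left, adjoint_vacOp, ← mul_apply_eq_comp, vacOp_mul_self] at h
  exact h

/-! ### The unitaries u_g and their linear span -/

variable (π : G →* (H ≃ₗᵢ[ℝ] H))

theorem norm_unit_apply (g : G) (ξ : K) : ‖unit π g ξ‖ = ‖ξ‖ := by
  have h1 : ⟪unit π g ξ, unit π g ξ⟫_ℂ = ⟪ξ, ξ⟫_ℂ := by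
    rw [← adjoint_inner_right, ← mul_apply_eq_comp, ← star_eq_adjoint, star_unit, unit_mul,
      inv_mul_cancel, unit_one, one_apply_eq_self]
  rw [inner_self_eq_norm_sq_to_K, inner_self_eq_norm_sq_to_K] at h1
  have h2 := congrArg Complex.re h1
  norm_cast at h2
  exact (pow_left_inj₀ (norm_nonneg _) (norm_nonneg _) two_ne_zero).1 h2

theorem norm_unit_le (g : G) : ‖unit π g‖ ≤ 1 :=
  opNorm_le_bound _ zero_le_one fun ξ => by rw [norm_unit_apply, one_mul]

/-- At `vac`, u_g agrees with the shift, which lies in the commutant; so right multiplication by u_g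
becomes a shift of vectors. -/
theorem apply_shift_vac {x : K →L[ℂ] K} (hx : x ∈ bogoljubovCrossedProduct π) (g : G) :
    x (unit π g (vac G H)) = shift H g (x (vac G H)) := by
  rw [unit_vac, ← shift_vac, ← mul_apply_eq_comp,
    VonNeumannAlgebra.mem_commutant_iff.1 (shift_mem_commutant π g) x hx]
  rfl

/-- The linear span of the unitaries `u_g`. -/
def groupSpan : Submodule ℂ (K →L[ℂ] K) := Submodule.span ℂ (Set.range (unit π))

theorem groupSpan_le : groupSpan π ≤
    Subalgebra.toSubmodule (implementedAlgebra (bogoljubovCrossedProduct π) (vac G H)) := by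
  refine Submodule.span_le.2 ?_
  rintro _ ⟨g, rfl⟩
  exact unit_implemented π g

theorem star_mem_groupSpan {p : K →L[ℂ] K} (hp : p ∈ groupSpan π) : star p ∈ groupSpan π := by
  induction hp using Submodule.span_induction with
  | mem p hp =>
    obtain ⟨g, rfl⟩ := hp
    rw [star_unit]
    exact Submodule.subset_span ⟨g⁻¹, rfl⟩
  | zero => rw [star_zero]; exact Submodule.zero_mem _
  | add p q _ _ hp hq => rw [star_add]; exact Submodule.add_mem _ hp hq
  | smul c p _ hp => rw [star_smul]; exact Submodule.smul_mem _ _ hp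

/-- The vectors u_g(x ⊗ δ_h) sit in the distinct coordinates gh and have norm ‖x‖, so the inner
product is that of the coefficient families in ℓ²(G). -/
theorem inner_groupSpan {p q : K →L[ℂ] K} (hp : p ∈ groupSpan π) (hq : q ∈ groupSpan π) (h : G)
    (x : F) : ⟪p (deltaVec h x), q (deltaVec h x)⟫_ℂ =
      ⟪p (vac G H), q (vac G H)⟫_ℂ * (‖x‖ : ℂ) ^ 2 := by
  induction hp using Submodule.span_induction with
  | mem p hp =>
    obtain ⟨g, rfl⟩ := hp
    induction hq using Submodule.span_induction with
    | mem q hq =>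
      obtain ⟨k, rfl⟩ := hq
      rw [unit_vac, unit_vac, unit, unit, tensorShift_deltaVec, tensorShift_deltaVec,
        inner_deltaVec_left, inner_deltaVec_left, deltaVec_apply, deltaVec_apply]
      by_cases hgk : g = k
      · subst hgk
        rw [if_pos rfl, if_pos rfl, inner_self_eq_norm_sq_to_K, inner_self_eq_norm_sq_to_K,
          norm_koopman_apply, Fock.norm_vacuum]
        simp
      · rw [if_neg hgk, if_neg (fun h1 => hgk (mul_right_cancel h1))]
        simp
    | zero => simp
    | add q q' _ _ hq hq' => simp only [add_apply, inner_add_right, hq, hq', add_mul]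
    | smul c q _ hq => simp only [smul_apply, inner_smul_right, hq, mul_assoc]
  | zero => simp
  | add p p' _ _ hp hp' => simp only [add_apply, inner_add_left, hp, hp', add_mul]
  | smul c p _ hp => simp only [smul_apply, inner_smul_left, hp, mul_assoc]

theorem norm_groupSpan_deltaVec {p : K →L[ℂ] K} (hp : p ∈ groupSpan π) (h : G) (x : F) :
    ‖p (deltaVec h x)‖ = ‖p (vac G H)‖ * ‖x‖ := by
  have h1 := inner_groupSpan π hp hp h x
  rw [inner_self_eq_norm_sq_to_K, inner_self_eq_norm_sq_to_K] at h1
  have h2 : ‖p (deltaVec h x)‖ ^ 2 = ‖p (vac G H)‖ ^ 2 * ‖x‖ ^ 2 := by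
    refine Complex.ofReal_injective ?_
    push_cast
    exact h1
  rw [← mul_pow] at h2
  exact (pow_left_inj₀ (norm_nonneg _) (by positivity) two_ne_zero).1 h2

/-- The operator norm of p is not controlled by ‖p `vac`‖, but its coefficients at x ⊗ δ_h are, by
moving p to the left as its adjoint. This replaces a uniform norm bound on approximating sequences.
-/
theorem norm_inner_groupSpan_le {p : K →L[ℂ] K} (hp : p ∈ groupSpan π) (h : G) (x : F) (ζ : K) :
    ‖⟪deltaVec h x, p ζ⟫_ℂ‖ ≤ ‖p (vac G H)‖ * ‖x‖ * ‖ζ‖ := by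
  rw [← adjoint_inner_left, ← star_eq_adjoint]
  refine (norm_inner_le_norm _ _).trans ?_
  rw [norm_groupSpan_deltaVec π (star_mem_groupSpan π hp),
    norm_star_of_implemented (groupSpan_le π hp)]

theorem commute_groupSpan {p y : K →L[ℂ] K} (hp : p ∈ groupSpan π)
    (hy : ∀ g, unit π g * y = y * unit π g) : p * y = y * p := by
  induction hp using Submodule.span_induction with
  | mem q hq => obtain ⟨g, rfl⟩ := hq; exact hy g
  | zero => simp
  | add q q' _ _ h1 h2 => rw [add_mul, mul_add, h1, h2]
  | smul c q _ h1 => rw [smul_mul_assoc, mul_smul_comm, h1]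

theorem vacOp_mem_closure (ξ : K) : vacOp G H ξ ∈
    closure ((fun p : K →L[ℂ] K => p (vac G H)) '' (groupSpan π)) := by
  let φ : (K →L[ℂ] K) →ₗ[ℂ] K :=
    { toFun := fun n => n (vac G H)
      map_add' := fun _ _ => rfl
      map_smul' := fun _ _ => rfl }
  refine mem_of_deltaVec_mem (s := Set.range Fock.word) Fock.dense_span_words
    (S := (((groupSpan π).map φ).topologicalClosure).comap (vacOp G H).toLinearMap)
    ((Submodule.isClosed_topologicalClosure _).preimage (vacOp G H).continuous) ?_ ξ
  rintro g _ ⟨v, rfl⟩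
  refine Submodule.le_topologicalClosure _ ?_
  change vacOp G H (deltaVec g (Fock.word v)) ∈ _
  rw [vacOp_deltaVec, Fock.vacuumProj_apply, map_smul, ← unit_vac π]
  exact Submodule.smul_mem _ _ ⟨unit π g, Submodule.subset_span ⟨g, rfl⟩, rfl⟩

/-- An operator commuting with the commutant of the crossed product belongs to the group algebra as
soon as it maps the vacuum vector to `Ω ⊗ ℓ²(G)`. -/
theorem mem_groupAlgebra_of_vacOp {z : K →L[ℂ] K}
    (hz : ∀ y ∈ (bogoljubovCrossedProduct π).commutant, z * y = y * z)
    (hv : vacOp G H (z (vac G H)) = z (vac G H)) : z ∈ bogoljubovGroupAlgebra π := by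
  have hmem := vacOp_mem_closure π (z (vac G H))
  rw [hv] at hmem
  obtain ⟨u, hu, hlim⟩ := mem_closure_iff_seq_limit.1 hmem
  choose p hp hpu using hu
  have hlim' : Tendsto (fun k => p k (vac G H)) atTop (𝓝 (z (vac G H))) := by
    simpa only [hpu] using hlim
  obtain ⟨C, hC⟩ := hlim'.norm.bddAbove_range
  have hC' : ∀ k, ‖p k (vac G H)‖ ≤ C := fun k => hC ⟨k, rfl⟩
  have hd : Dense (Submodule.span ℂ {ξ : K | ∃ y ∈ (bogoljubovCrossedProduct π).commutant,
      ξ = y (vac G H)} : Set K) := by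
    intro ζ
    refine closure_mono ?_ (dense_implemented_vac π ζ)
    rintro _ ⟨n, ⟨-, m, hm, h1, -⟩, rfl⟩
    exact Submodule.subset_span ⟨m, hm, h1.symm⟩
  -- By the uniform bound it suffices to take ζ = y `vac` with y in the commutant; there p_k and z
  -- both commute with y, and p_k `vac` → z `vac`.
  have hweak : ∀ (h : G) (x : F) (ζ : K),
      Tendsto (fun k => ⟪deltaVec h x, p k ζ⟫_ℂ) atTop (𝓝 ⟪deltaVec h x, z ζ⟫_ℂ) := by
    intro h x ζ
    have h1 := tendsto_zero_of_dense_span hd (l := atTop)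
      (fun k : ℕ => (innerSL ℂ (deltaVec h x) ∘L (p k - z)).toLinearMap)
      (C * ‖x‖ + ‖x‖ * ‖z‖) (fun k ζ => ?_) ?_ ζ
    · rw [← tendsto_sub_nhds_zero_iff]
      simpa using h1
    · change ‖⟪deltaVec h x, p k ζ - z ζ⟫_ℂ‖ ≤ _
      rw [inner_sub_right, add_mul]
      refine (norm_sub_le _ _).trans (add_le_add ?_ ?_)
      · refine (norm_inner_groupSpan_le π (hp k) h x ζ).trans ?_
        have := hC' k
        gcongr
      · refine (norm_inner_le_norm _ _).trans ?_
        rw [norm_deltaVec, mul_assoc]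
        exact mul_le_mul_of_nonneg_left (z.le_opNorm _) (norm_nonneg _)
    · rintro _ ⟨y, hy, rfl⟩
      have h2 : ∀ k, p k (y (vac G H)) = y (p k (vac G H)) := fun k => by
        rw [← mul_apply_eq_comp, VonNeumannAlgebra.mem_commutant_iff.1 hy _
          (groupSpan_le π (hp k)).1, mul_apply_eq_comp]
      have h3 : z (y (vac G H)) = y (z (vac G H)) := by
        rw [← mul_apply_eq_comp, hz y hy, mul_apply_eq_comp]
      have h4 := (tendsto_const_nhds (x := deltaVec h x)).inner (𝕜 := ℂ)
        (tendsto_sub_nhds_zero_iff.2 ((y.continuous.tendsto _).comp hlim'))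
      rw [inner_zero_right] at h4
      refine h4.congr fun k => ?_
      change _ = ⟪deltaVec h x, p k (y (vac G H)) - z (y (vac G H))⟫_ℂ
      rw [h2, h3]
      rfl
  -- The vectors p_k y `vac` = y p_k `vac` tend weakly to z y `vac` and in norm to y z `vac`.
  have hvac : ∀ y : K →L[ℂ] K, (∀ g, unit π g * y = y * unit π g) →
      z (y (vac G H)) = y (z (vac G H)) := by
    intro y hy
    refine eq_of_inner_deltaVec fun h v => ?_
    refine tendsto_nhds_unique (hweak h (Fock.word v) (y (vac G H))) ?_
    refine ((tendsto_const_nhds (x := deltaVec h (Fock.word v))).inner (𝕜 := ℂ)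
      ((y.continuous.tendsto _).comp hlim')).congr fun k => ?_
    rw [← mul_apply_eq_comp (p k), commute_groupSpan π (hp k) hy]
    rfl
  refine mem_generated_iff.2 fun y hy => ?_
  have hy' : ∀ g, unit π g * y = y * unit π g := fun g => (hy _ ⟨g, rfl⟩).1
  refine ContinuousLinearMap.ext_on hd ?_
  rintro _ ⟨m, hm, rfl⟩
  -- As m is in the commutant, ym still commutes with every u_g; hence z y m `vac` = y m z `vac` = y
  -- z m `vac`, on vectors with dense span.
  have h1 := hvac (y * m) fun g => by
    rw [← mul_assoc, hy', mul_assoc, mul_assoc,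
      VonNeumannAlgebra.mem_commutant_iff.1 hm _ (unit_mem_crossedProduct π g)]
  have h2 : z (m (vac G H)) = m (z (vac G H)) := by
    rw [← mul_apply_eq_comp, hz m hm, mul_apply_eq_comp]
  simp only [mul_apply_eq_comp] at h1 ⊢
  rw [h1, h2]

variable {π}

/-- The conditional expectation onto the group algebra of an abelian group, for a mixing
representation. -/
theorem IsMixing.exists_expectation [Infinite G] (hπ : IsMixing π) {x : K →L[ℂ] K}
    (hx : x ∈ bogoljubovCrossedProduct π) : ∃ z ∈ bogoljubovGroupAlgebra π, ‖z‖ ≤ ‖x‖ ∧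
      z (vac G H) = vacOp G H (x (vac G H)) := by
  set A : G → K →L[ℂ] K := fun h => unit π h * x * unit π h⁻¹ with hA
  have hAM : ∀ h, A h ∈ bogoljubovCrossedProduct π := fun h =>
    mul_mem (mul_mem (unit_mem_crossedProduct π h) hx) (unit_mem_crossedProduct π h⁻¹)
  have hAn : ∀ h, ‖A h‖ ≤ ‖x‖ := fun h => by
    calc ‖A h‖ ≤ ‖unit π h‖ * ‖x‖ * ‖unit π h⁻¹‖ :=
          (norm_mul_le _ _).trans (mul_le_mul_of_nonneg_right (norm_mul_le _ _) (norm_nonneg _))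
      _ ≤ 1 * ‖x‖ * 1 := by
          have h1 := norm_unit_le π h
          have h2 := norm_unit_le π h⁻¹
          gcongr
      _ = ‖x‖ := by ring
  -- Conjugation by u_h fixes L(G), as G is abelian, while mixing sends the remaining part weakly to
  -- zero as h leaves finite sets; the limit is the expectation.
  obtain ⟨z, hz, hlim⟩ := exists_weak_limit (hyperfilter G) hAn
  have hzv : z (vac G H) = vacOp G H (x (vac G H)) := by
    refine eq_of_inner_deltaVec fun k v => ?_
    rw [← inner_conj_symm, ← inner_conj_symm (deltaVec k (Fock.word v))]
    congr 1
    refine tendsto_nhds_unique (hlim (vac G H) (deltaVec k (Fock.word v))) ?_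
    -- At `vac`, u_h⁻¹ becomes a shift, passes x, and cancels the translation in u_h; only ℱ(π(h)) ⊗
    -- 1 remains.
    have h1 : ∀ h, A h (vac G H) = tensorShift (koopman π h) 1 (x (vac G H)) := by
      intro h
      have h2 : tensorShift (koopman π h) (1 : G) = unit π h * shift H h⁻¹ := by
        rw [unit, shift, tensorShift_mul, mul_one, mul_inv_cancel]
      rw [h2, hA]
      dsimp only
      rw [mul_apply_eq_comp, mul_apply_eq_comp, apply_shift_vac π hx, mul_apply_eq_comp]
    have h2 := ((hπ.tendsto_inner_koopman v (x (vac G H) k)).star).mono_left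
      (hyperfilter_le_cofinite (α := G))
    have h3 : ⟪vacOp G H (x (vac G H)), deltaVec k (Fock.word v)⟫_ℂ =
        star ⟪Fock.word v, Fock.vacuumProj _ (x (vac G H) k)⟫_ℂ := by
      rw [← inner_conj_symm, inner_deltaVec_left, vacOp_apply]
      rfl
    rw [h3]
    refine h2.congr fun h => ?_
    rw [h1, ← inner_conj_symm (tensorShift (koopman π h) (1 : G) (x (vac G H))),
      inner_deltaVec_left, tensorShift_apply, inv_one, one_mul]
    rfl
  refine ⟨z, mem_groupAlgebra_of_vacOp π (fun y hy => ?_) ?_, hz, hzv⟩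
  · refine ContinuousLinearMap.ext fun η => ext_inner_right ℂ fun ξ => ?_
    have hl := hlim η (adjoint y ξ)
    rw [adjoint_inner_right] at hl
    rw [mul_apply_eq_comp, mul_apply_eq_comp]
    refine tendsto_nhds_unique (hlim (y η) ξ) (hl.congr fun h => ?_)
    rw [adjoint_inner_right, ← mul_apply_eq_comp, ← mul_apply_eq_comp,
      VonNeumannAlgebra.mem_commutant_iff.1 hy _ (hAM h)]
  · rw [hzv, ← mul_apply_eq_comp, vacOp_mul_self]

end Expectation

/-! ### Asymptotic orthogonality -/

theorem tendsto_inner_zero_left {V : Type*} [NormedAddCommGroup V] [InnerProductSpace ℂ V]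
    {l : Filter ℕ} {a b : ℕ → V} {C : ℝ} (ha : Tendsto a l (𝓝 0)) (hb : ∀ n, ‖b n‖ ≤ C) :
    Tendsto (fun n => ⟪a n, b n⟫_ℂ) l (𝓝 0) := by
  refine squeeze_zero_norm (a := fun n => ‖a n‖ * C) (fun n => ?_)
    (by simpa using ha.norm.mul_const C)
  exact (norm_inner_le_norm _ _).trans (mul_le_mul_of_nonneg_left (hb n) (norm_nonneg _))

theorem tendsto_inner_zero_right {V : Type*} [NormedAddCommGroup V] [InnerProductSpace ℂ V]
    {l : Filter ℕ} {a b : ℕ → V} {C : ℝ} (ha : ∀ n, ‖a n‖ ≤ C) (hb : Tendsto b l (𝓝 0)) :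
    Tendsto (fun n => ⟪a n, b n⟫_ℂ) l (𝓝 0) := by
  refine squeeze_zero_norm (a := fun n => C * ‖b n‖) (fun n => ?_)
    (by simpa using hb.norm.const_mul C)
  exact (norm_inner_le_norm _ _).trans (mul_le_mul_of_nonneg_right (ha n) (norm_nonneg _))

theorem tendsto_clm_zero {V : Type*} [NormedAddCommGroup V] [NormedSpace ℂ V] (T : V →L[ℂ] V)
    {l : Filter ℕ} {a : ℕ → V} (ha : Tendsto a l (𝓝 0)) :
    Tendsto (fun n => T (a n)) l (𝓝 0) := by
  have h := (T.continuous.tendsto 0).comp ha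
  rwa [map_zero] at h

section Sequences

variable {G : Type*} [CommGroup G] {H : Type*} [NormedAddCommGroup H] [InnerProductSpace ℝ H]

local notation "F" => Fock (Complexification H)
local notation "K" => lp (fun _ : G => Fock (Complexification H)) 2

open Complexification (ofReal)

variable (π : G →* (H ≃ₗᵢ[ℝ] H))

/-- A sequence of vectors without asymptotic component on words which are empty or end with a given
letter. -/
def RightNegligible (l : Filter ℕ) (ζ : ℕ → K) : Prop :=
  Tendsto (fun n => vacOp G H (ζ n)) l (𝓝 0) ∧
    ∀ e, Tendsto (fun n => adjoint (rightOp π e) (ζ n)) l (𝓝 0)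

variable {π}

theorem RightNegligible.unit {l : Filter ℕ} {ζ : ℕ → K} (h : RightNegligible π l ζ) (g : G) :
    RightNegligible π l fun n => unit π g (ζ n) := by
  refine ⟨?_, fun e => ?_⟩
  · have h1 : vacOp G H * FreeBogoljubov.unit π g = FreeBogoljubov.unit π g * vacOp G H := by
      rw [vacOp, FreeBogoljubov.unit, tensorShift_mul, tensorShift_mul, one_mul, mul_one]
      congr 1
      refine Fock.ext_words fun v => ?_
      have h2 : koopman π g (Fock.word []) = Fock.word [] := koopman_vacuum π g
      cases v with
      | nil => simp [mul_apply_eq_comp, Fock.vacuumProj_word_nil, h2]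
      | cons e v => simp [mul_apply_eq_comp, Fock.vacuumProj_word_cons, koopman,
          Fock.secondQuantization_word]
    refine (tendsto_clm_zero (FreeBogoljubov.unit π g) h.1).congr fun n => ?_
    rw [← mul_apply_eq_comp, ← h1]
    rfl
  · refine (tendsto_clm_zero (FreeBogoljubov.unit π g) (h.2 e)).congr fun n =>
      lp.ext (funext fun k => ?_)
    rw [adjoint_rightOp_apply, FreeBogoljubov.unit, tensorShift_apply, tensorShift_apply,
      adjoint_rightOp_apply, ← mul_apply_eq_comp, ← adjoint_rightCreation_mul_koopman,
      apply_apply_inv_mul]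
    rfl

theorem vacOp_mul_leftOp (e : H) : vacOp G H * leftOp G e = 0 := by
  rw [vacOp, leftOp, tensorShift_mul, Fock.vacuumProj_mul_creation, tensorShift_zero]

theorem RightNegligible.leftOp {l : Filter ℕ} {ζ : ℕ → K} (h : RightNegligible π l ζ) (f : H) :
    RightNegligible π l fun n => leftOp G f (ζ n) := by
  refine ⟨?_, fun e => ?_⟩
  · simp only [← mul_apply_eq_comp, vacOp_mul_leftOp, zero_apply, tendsto_const_nhds]
  -- D collects the coefficients of the vacuum correction, which depend on the coordinate k through
  -- the twist but stay bounded by ‖e‖ ‖f‖.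
  · let D : K →L[ℂ] K := diagOp (fun k => (⟪π k e, f⟫_ℝ : ℂ) • (1 : F →L[ℂ] F)) (‖e‖ * ‖f‖)
      fun k => by
        rw [norm_smul, Complex.norm_real]
        refine (mul_le_of_le_one_right (norm_nonneg _) ?_).trans ?_
        · exact norm_id_le
        · refine (norm_inner_le_norm _ _).trans_eq ?_
          rw [LinearIsometryEquiv.norm_map]
    have h1 := (tendsto_clm_zero (FreeBogoljubov.leftOp G f) (h.2 e)).add (tendsto_clm_zero D h.1)
    rw [add_zero] at h1
    refine h1.congr fun n => lp.ext (funext fun k => ?_)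
    rw [lp.coeFn_add, Pi.add_apply, adjoint_rightOp_apply, FreeBogoljubov.leftOp, tensorShift_apply,
      tensorShift_apply, diagOp_apply, adjoint_rightOp_apply, vacOp_apply, inv_one, one_mul,
      ← mul_apply_eq_comp (adjoint _), Fock.adjoint_rightCreation_mul_creation, inner_ofReal]
    rfl

theorem RightNegligible.leftOp_prod {l : Filter ℕ} {ζ : ℕ → K} (h : RightNegligible π l ζ)
    (v : List H) :
    RightNegligible π l fun n => (v.map (FreeBogoljubov.leftOp G)).prod (ζ n) := by
  induction v with
  | nil => exact h
  | cons e v ih => exact ih.leftOp e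

/-- Moving coordinate h⁻¹k to k changes the twist by π(h⁻¹), which commutativity allows to be
absorbed into e. -/
theorem shift_mul_rightOp (h : G) (e : H) :
    shift H h * rightOp π e = rightOp π (π h⁻¹ e) * shift H h := by
  refine ext_lp fun ξ k => ?_
  have h1 : π k (π h⁻¹ e) = π (h⁻¹ * k) e := by
    rw [mul_comm, map_mul]
    rfl
  rw [mul_apply_eq_comp, mul_apply_eq_comp, shift, tensorShift_apply, rightOp, rightOp,
    diagOp_apply, diagOp_apply, tensorShift_apply, h1]
  rfl

theorem adjoint_leftOp_mul_unit (g : G) (e : H) :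
    adjoint (leftOp G e) * unit π g = unit π g * adjoint (leftOp G (π g⁻¹ e)) := by
  have h1 : π g (π g⁻¹ e) = e := by
    rw [map_inv]
    exact LinearIsometryEquiv.apply_symm_apply (π g) e
  have h2 := adjoint_creation_mul_koopman π g (π g⁻¹ e)
  rw [h1] at h2
  rw [leftOp, leftOp, adjoint_tensorShift, adjoint_tensorShift, unit, tensorShift_mul,
    tensorShift_mul, h2, inv_one, one_mul, mul_one]

/-- The vectors `W(v) u_g ξ_n` and `η_n W(w) u_h` are asymptotically orthogonal. -/
theorem tendsto_inner_wick {l : Filter ℕ} {ξ η : ℕ → K} {C : ℝ} (hξC : ∀ n, ‖ξ n‖ ≤ C)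
    (hηC : ∀ n, ‖η n‖ ≤ C) (hξ : RightNegligible π l ξ)
    (hξl : ∀ e, Tendsto (fun n => adjoint (leftOp G e) (ξ n)) l (𝓝 0))
    (hη : ∀ e, Tendsto (fun n => adjoint (rightOp π e) (η n)) l (𝓝 0))
    (v : List H) (g : G) (e : H) (w : List H) (h : G) :
    Tendsto (fun n => ⟪wick (leftOp G) v (unit π g (ξ n)),
      shift H h (wick (rightOp π) (e :: w) (η n))⟫_ℂ) l (𝓝 0) := by
  have hbd : ∀ (T : K →L[ℂ] K) (ζ : ℕ → K), (∀ n, ‖ζ n‖ ≤ C) → ∀ n, ‖T (ζ n)‖ ≤ ‖T‖ * C :=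
    fun T ζ hζ n => (T.le_opNorm _).trans (mul_le_mul_of_nonneg_left (hζ n) (norm_nonneg _))
  set P : K →L[ℂ] K := (v.map (leftOp G)).prod with hP
  set R : K →L[ℂ] K := (w.map (rightOp π)).prod with hR
  have h1 : Tendsto (fun n => wick (leftOp G) v (unit π g (ξ n)) - P (unit π g (ξ n))) l (𝓝 0) :=
    tendsto_wick_sub adjoint_leftOp_mul_leftOp (fun f => by
      refine (tendsto_clm_zero (unit π g) (hξl (π g⁻¹ f))).congr fun n => ?_
      rw [← mul_apply_eq_comp (adjoint _), adjoint_leftOp_mul_unit]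
      rfl) v
  have h2 : Tendsto (fun n => wick (rightOp π) (e :: w) (η n) - (rightOp π e * R) (η n)) l
      (𝓝 0) := by
    simpa only [List.map_cons, List.prod_cons] using
      tendsto_wick_sub (adjoint_rightOp_mul_rightOp π) hη (e :: w)
  have h3 := tendsto_inner_zero_left h1 (hbd (shift H h * wick (rightOp π) (e :: w)) η hηC)
  have h4 := tendsto_inner_zero_right (hbd (P * unit π g) ξ hξC) (tendsto_clm_zero (shift H h) h2)
  -- The outermost right creation operator carries the last letter of the second vector. Moved past
  -- the shift and across the inner product, it becomes an adjoint that asymptotically annihilates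
  -- the first vector.
  have h5 := tendsto_inner_zero_left (((hξ.unit g).leftOp_prod v).2 (π h⁻¹ e))
    (hbd (shift H h * R) η hηC)
  have h6 := (h3.add h4).add h5
  simp only [add_zero] at h6
  refine h6.congr fun n => ?_
  have h7 : shift H h (rightOp π e (R (η n))) = rightOp π (π h⁻¹ e) (shift H h (R (η n))) := by
    rw [← mul_apply_eq_comp, shift_mul_rightOp, mul_apply_eq_comp]
  rw [adjoint_inner_left]
  simp only [mul_apply_eq_comp, inner_sub_left, map_sub, inner_sub_right, h7, ← hP]
  ring

/-- Asymptotic orthogonality of `a X_n` and `Y_n β` for bounded sequences in the crossed product, an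
arbitrary element `a` and a vector `β` orthogonal to `Ω ⊗ ℓ²(G)`. -/
theorem tendsto_inner_of_negligible {l : Filter ℕ} {X Y : ℕ → K →L[ℂ] K} {C : ℝ}
    (hX : ∀ n, X n ∈ bogoljubovCrossedProduct π) (hY : ∀ n, Y n ∈ bogoljubovCrossedProduct π)
    (hXC : ∀ n, ‖X n‖ ≤ C) (hYC : ∀ n, ‖Y n‖ ≤ C)
    (hξ : RightNegligible π l fun n => X n (vac G H))
    (hξl : ∀ e, Tendsto (fun n => adjoint (leftOp G e) (X n (vac G H))) l (𝓝 0))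
    (hη : ∀ e, Tendsto (fun n => adjoint (rightOp π e) (Y n (vac G H))) l (𝓝 0))
    {a : K →L[ℂ] K} (ha : a ∈ bogoljubovCrossedProduct π) {β : K} (hβ : vacOp G H β = 0) :
    Tendsto (fun n => ⟪a (X n (vac G H)), Y n β⟫_ℂ) l (𝓝 0) := by
  have hC : 0 ≤ C := (norm_nonneg _).trans (hXC 0)
  have hv : ∀ (Z : ℕ → K →L[ℂ] K), (∀ n, ‖Z n‖ ≤ C) → ∀ n, ‖Z n (vac G H)‖ ≤ C := fun Z hZ n => by
    refine ((Z n).le_opNorm _).trans ?_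
    rw [norm_vac, mul_one]
    exact hZ n
  have hYβ : ∀ n ζ, ‖Y n ζ‖ ≤ C * ‖ζ‖ := fun n ζ =>
    ((Y n).le_opNorm _).trans (mul_le_mul_of_nonneg_right (hYC n) (norm_nonneg _))
  have hd : Dense (Submodule.span ℂ
      {ξ : K | ∃ g : G, ∃ x ∈ Set.range realWord, ξ = deltaVec g x} : Set K) :=
    dense_span_deltaVec dense_span_realWord
  have hgen : ∀ (v : List H) (g : G), Tendsto (fun n =>
      ⟪(wick (leftOp G) v * unit π g) (X n (vac G H)), Y n β⟫_ℂ) l (𝓝 0) := by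
    intro v g
    set W : K →L[ℂ] K := wick (leftOp G) v * unit π g with hW
    -- Inserting 1 - `vacOp`, which fixes β, allows testing on all words: the empty word is
    -- annihilated and the nonempty ones are unchanged.
    have h1 := tendsto_zero_of_dense_span hd (l := l)
      (fun n : ℕ => (innerSL ℂ (W (X n (vac G H))) ∘L (Y n * (1 - vacOp G H))).toLinearMap)
      (‖W‖ * C * (C * ‖1 - vacOp G H‖)) (fun n ζ => ?_) ?_ β
    · refine h1.congr fun n => ?_
      change ⟪W (X n (vac G H)), Y n (β - vacOp G H β)⟫_ℂ = _
      rw [hβ, sub_zero]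
    · change ‖⟪W (X n (vac G H)), Y n ((1 - vacOp G H) ζ)⟫_ℂ‖ ≤ _
      refine (norm_inner_le_norm _ _).trans ?_
      rw [mul_assoc (‖W‖ * C)]
      refine mul_le_mul ?_ ?_ (norm_nonneg _) (by positivity)
      · exact (W.le_opNorm _).trans (mul_le_mul_of_nonneg_left (hv X hXC n) (norm_nonneg _))
      · refine (hYβ n _).trans ?_
        rw [mul_assoc]
        exact mul_le_mul_of_nonneg_left ((1 - vacOp G H).le_opNorm _) hC
    · rintro _ ⟨h, _, ⟨w, rfl⟩, rfl⟩
      change Tendsto (fun n => ⟪W (X n (vac G H)),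
        Y n (deltaVec h (realWord w) - vacOp G H (deltaVec h (realWord w)))⟫_ℂ) l (𝓝 0)
      rw [vacOp_deltaVec]
      rcases w with _ | ⟨f, w⟩
      · have h2 : Fock.vacuumProj (Complexification H) (realWord []) = realWord [] :=
          Fock.vacuumProj_word_nil
        simp [h2, tendsto_const_nhds]
      · have h2 : Fock.vacuumProj (Complexification H) (realWord (f :: w)) = 0 :=
          Fock.vacuumProj_word_cons _ _
        have hne : (f :: w).reverse ≠ [] := by simp
        obtain ⟨e, u, hu⟩ := List.exists_cons_of_ne_nil hne
        -- A commutant element creates this vector from `vac`, so it passes through Y_n and acts on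
        -- Y_n `vac`.
        have h3 : deltaVec h (realWord (f :: w)) =
            shift H h (wick (rightOp π) (e :: u) (vac G H)) := by
          rw [wick_rightOp_apply, ← hu, List.reverse_reverse, shift, tensorShift_deltaVec, mul_one]
          rfl
        have h4 : shift H h * wick (rightOp π) (e :: u) ∈ (bogoljubovCrossedProduct π).commutant :=
          mul_mem (shift_mem_commutant π h)
            (wick_mem (A := (bogoljubovCrossedProduct π).commutant.toStarSubalgebra.toSubalgebra)
              (rightSemicircular_mem_commutant π) _)
        refine (tendsto_inner_wick (hv X hXC) (hv Y hYC) hξ hξl hη v g e u h).congr fun n => ?_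
        rw [h2, map_zero, sub_zero, h3]
        have h5 := DFunLike.congr_fun
          (VonNeumannAlgebra.mem_commutant_iff.1 h4 _ (hY n)) (vac G H)
        simp only [mul_apply_eq_comp] at h5
        rw [h5, hW, mul_apply_eq_comp]
  have hspan : ∀ p ∈ Submodule.span ℂ {n | ∃ (v : List H) (g : G),
      n = wick (leftOp G) v * unit π g},
      Tendsto (fun n => ⟪p (X n (vac G H)), Y n β⟫_ℂ) l (𝓝 0) := by
    intro p hp
    induction hp using Submodule.span_induction with
    | mem p hp => obtain ⟨v, g, rfl⟩ := hp; exact hgen v g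
    | zero => simp [tendsto_const_nhds]
    | add p q _ _ hp hq => simpa [inner_add_left] using hp.add hq
    | smul c p _ hp => simpa [inner_smul_left, mul_comm] using hp.const_mul (starRingEnd ℂ c)
  rw [Metric.tendsto_nhds]
  intro ε hε
  have hδ : 0 < ε / 2 / (C * (C * ‖β‖) + 1) := by positivity
  obtain ⟨_, ⟨p, hp, rfl⟩, hpa⟩ := Metric.mem_closure_iff.1
    (dense_wick_mul_unit_vac π (a (vac G H))) _ hδ
  have hpM : p ∈ bogoljubovCrossedProduct π := (span_wick_mul_unit_le π hp).1
  -- Approximating a at `vac` gives no control of ‖a - p‖; taking adjoints twice, by traciality,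
  -- puts the bounded factor X_n* outside.
  have hsub : ∀ n, ‖(a - p) (X n (vac G H))‖ ≤ C * ‖(a - p) (vac G H)‖ := by
    intro n
    have h1 := norm_star_apply_le (dense_implemented_vac π)
      (star_mem (mul_mem (sub_mem ha hpM) (hX n)))
    rw [star_star, star_mul, mul_apply_eq_comp, mul_apply_eq_comp] at h1
    refine h1.trans (((star (X n)).le_opNorm _).trans ?_)
    exact mul_le_mul ((norm_star (X n)).le.trans (hXC n))
      (norm_star_apply_le (dense_implemented_vac π) (sub_mem ha hpM))
      (norm_nonneg _) hC
  filter_upwards [Metric.tendsto_nhds.1 (hspan p hp) (ε / 2) (by positivity)] with n hn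
  rw [dist_zero_right] at hn ⊢
  have h1 : ⟪a (X n (vac G H)), Y n β⟫_ℂ =
      ⟪(a - p) (X n (vac G H)), Y n β⟫_ℂ + ⟪p (X n (vac G H)), Y n β⟫_ℂ := by
    rw [← inner_add_left, sub_apply, sub_add_cancel]
  have h2 : ‖⟪(a - p) (X n (vac G H)), Y n β⟫_ℂ‖ ≤ ε / 2 := by
    refine (norm_inner_le_norm _ _).trans ((mul_le_mul (hsub n) (hYβ n β) (norm_nonneg _)
      (by positivity)).trans ?_)
    rw [dist_eq_norm] at hpa
    have h3 : ‖(a - p) (vac G H)‖ ≤ ε / 2 / (C * (C * ‖β‖) + 1) := hpa.le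
    calc C * ‖(a - p) (vac G H)‖ * (C * ‖β‖)
        = (C * (C * ‖β‖)) * ‖(a - p) (vac G H)‖ := by ring
      _ ≤ (C * (C * ‖β‖) + 1) * (ε / 2 / (C * (C * ‖β‖) + 1)) := by
          refine mul_le_mul (by linarith) h3 (norm_nonneg _) (by positivity)
      _ = ε / 2 := by field_simp
  rw [h1]
  linarith [norm_add_le ⟪(a - p) (X n (vac G H)), Y n β⟫_ℂ ⟪p (X n (vac G H)), Y n β⟫_ℂ]

/-! ### Sequences representing elements of the ultraproduct -/

section Ultra

open Ultraproduct

theorem l2Norm_canonicalTrace (x : (bogoljubovCrossedProduct π).toStarSubalgebra) :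
    l2Norm (canonicalTrace π) x = ‖(x : K →L[ℂ] K) (vac G H)‖ := by
  refine (pow_left_inj₀ (IsFaithfulNormalTrace.l2Norm_nonneg _ x) (norm_nonneg _) two_ne_zero).1 ?_
  rw [(isFaithfulNormalTrace_canonicalTrace π).l2Norm_sq, ← inner_self_eq_norm_sq (𝕜 := ℂ),
    ← adjoint_inner_right]
  rfl

variable {ω : Ultrafilter ℕ} (hτ : IsFaithfulNormalTrace (bogoljubovCrossedProduct π)
  (canonicalTrace π))

theorem tendsto_l2Inner (X Y : BoundedSeq (bogoljubovCrossedProduct π)) :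
    Tendsto (fun n => ⟪(X n : K →L[ℂ] K) (vac G H), (Y n : K →L[ℂ] K) (vac G H)⟫_ℂ) ω
      (𝓝 (l2Inner hτ ω (mk hτ ω X) (mk hτ ω Y))) := by
  have h := tendsto_trace hτ ω (star X * Y)
  rw [map_mul, ← star_mk] at h
  refine h.congr fun n => ?_
  rw [← adjoint_inner_right]
  rfl

theorem koopman_tensorShift_eq (g : G) :
    tensorShift (koopman π g⁻¹) (1 : G) = unit π g⁻¹ * shift H g := by
  rw [unit, shift, tensorShift_mul, mul_one, inv_mul_cancel]

theorem norm_koopman_tensorShift_apply (g : G) (ξ : K) :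
    ‖tensorShift (koopman π g) (1 : G) ξ‖ = ‖ξ‖ := by
  refine (norm_map_iff_adjoint_comp_self _).2 ?_ ξ
  change adjoint (tensorShift (koopman π g) (1 : G)) * tensorShift (koopman π g) (1 : G) = 1
  rw [adjoint_tensorShift, tensorShift_mul, adjoint_koopman, ← koopman_mul, inv_mul_cancel,
    koopman_one, inv_one, one_mul, tensorShift_one_one]

/-- Multiply the commutator by the unitary u_g⁻¹: since x u_g `vac` is the shift of x `vac`, what
remains is, up to sign, the displacement under ℱ(π(g⁻¹)) ⊗ 1. -/
theorem norm_koopman_tensorShift_sub {x : K →L[ℂ] K} (hx : x ∈ bogoljubovCrossedProduct π)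
    (g : G) : ‖tensorShift (koopman π g⁻¹) 1 (x (vac G H)) - x (vac G H)‖ =
      ‖(unit π g * x - x * unit π g) (vac G H)‖ := by
  rw [sub_apply, mul_apply_eq_comp, mul_apply_eq_comp, apply_shift_vac π hx, norm_sub_rev,
    ← norm_unit_apply π g⁻¹ (unit π g _ - _), map_sub, koopman_tensorShift_eq,
    ← mul_apply_eq_comp (unit π g⁻¹) (unit π g), unit_mul, inv_mul_cancel, unit_one]
  rfl

theorem tendsto_sub_of_mem_relCommutant {X : BoundedSeq (bogoljubovCrossedProduct π)}
    (hX : mk hτ ω X ∈ relCommutant hτ ω (bogoljubovGroupAlgebra π)) (g : G) :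
    Tendsto (fun n => tensorShift (koopman π g⁻¹) 1 ((X n : K →L[ℂ] K) (vac G H)) -
      (X n : K →L[ℂ] K) (vac G H)) ω (𝓝 0) := by
  let c : (bogoljubovCrossedProduct π).toStarSubalgebra :=
    ⟨unit π g, unit_mem_crossedProduct π g⟩
  have h1 : mk hτ ω (.const c * X) = mk hτ ω (X * .const c) := by
    rw [map_mul, map_mul]
    exact hX c (unit_mem π g)
  have h2 := (mk_eq_mk_iff hτ ω).1 h1
  simp only [l2Norm_canonicalTrace] at h2
  rw [tendsto_zero_iff_norm_tendsto_zero]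
  refine h2.congr fun n => ?_
  rw [norm_koopman_tensorShift_sub (X n).2]
  rfl

theorem exists_bound_apply_vac (X : BoundedSeq (bogoljubovCrossedProduct π)) :
    ∃ C : ℝ, ∀ n, ‖(X n : K →L[ℂ] K) (vac G H)‖ ≤ C := by
  obtain ⟨C, hC⟩ := X.exists_bound
  refine ⟨C, fun n => ((X n : K →L[ℂ] K).le_opNorm _).trans ?_⟩
  rw [norm_vac, mul_one]
  exact hC n

variable [Infinite G]

theorem IsMixing.tendsto_adjoint_leftOp (hπ : IsMixing π)
    {X : BoundedSeq (bogoljubovCrossedProduct π)}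
    (hX : mk hτ ω X ∈ relCommutant hτ ω (bogoljubovGroupAlgebra π)) (e : H) :
    Tendsto (fun n => adjoint (leftOp G e) ((X n : K →L[ℂ] K) (vac G H))) ω (𝓝 0) := by
  obtain ⟨C, hC⟩ := exists_bound_apply_vac X
  refine tendsto_adjoint_of_mixing hπ adjoint_leftOp_mul_leftOp
    (fun g => tensorShift (koopman π g⁻¹) 1) (fun g x => norm_koopman_tensorShift_apply g⁻¹ x)
    (fun g e => ?_) hC (tendsto_sub_of_mem_relCommutant hτ hX) e
  have h1 : π g⁻¹ (π g e) = e := by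
    rw [map_inv]
    exact LinearIsometryEquiv.symm_apply_apply (π g) e
  have h2 := adjoint_creation_mul_koopman π g⁻¹ (π g e)
  rw [h1] at h2
  rw [leftOp, leftOp, adjoint_tensorShift, adjoint_tensorShift, tensorShift_mul, tensorShift_mul,
    h2, inv_one]

theorem IsMixing.tendsto_adjoint_rightOp (hπ : IsMixing π)
    {X : BoundedSeq (bogoljubovCrossedProduct π)}
    (hX : mk hτ ω X ∈ relCommutant hτ ω (bogoljubovGroupAlgebra π)) (e : H) :
    Tendsto (fun n => adjoint (rightOp π e) ((X n : K →L[ℂ] K) (vac G H))) ω (𝓝 0) := by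
  obtain ⟨C, hC⟩ := exists_bound_apply_vac X
  refine tendsto_adjoint_of_mixing hπ (adjoint_rightOp_mul_rightOp π)
    (fun g => tensorShift (koopman π g⁻¹) 1) (fun g x => norm_koopman_tensorShift_apply g⁻¹ x)
    (fun g e => ext_lp fun ξ k => ?_) hC (tendsto_sub_of_mem_relCommutant hτ hX) e
  -- Commutativity makes ℱ(π(g⁻¹)) ⊗ 1 compatible with the twist by π(k).
  have h1 : π g⁻¹ (π k (π g e)) = π k e := by
    have h2 : π g⁻¹ * (π k * π g) = π k := by
      rw [← map_mul, ← map_mul, mul_comm k, inv_mul_cancel_left]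
    exact congrArg (fun U : H ≃ₗᵢ[ℝ] H => U e) h2
  have h2 := adjoint_rightCreation_mul_koopman π g⁻¹ (π k (π g e))
  rw [h1] at h2
  rw [mul_apply_eq_comp, mul_apply_eq_comp, adjoint_rightOp_apply, tensorShift_apply,
    tensorShift_apply, adjoint_rightOp_apply, inv_one, one_mul, ← mul_apply_eq_comp, h2]
  rfl

/-- The expectations z_n of X_n are bounded by ‖X_n‖, so they define an element of L(G)^ω; pairing
it with X gives the limit of ‖`vacOp` (X_n `vac`)‖². -/
theorem IsMixing.tendsto_vacOp (hπ : IsMixing π) {X : BoundedSeq (bogoljubovCrossedProduct π)}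
    (hX : mk hτ ω X ∈ orthogonal hτ ω (bogoljubovGroupAlgebra π)) :
    Tendsto (fun n => vacOp G H ((X n : K →L[ℂ] K) (vac G H))) ω (𝓝 0) := by
  choose z hz hzn hzv using fun n => hπ.exists_expectation (X n).2
  obtain ⟨C, hC⟩ := X.exists_bound
  let Z : BoundedSeq (bogoljubovCrossedProduct π) :=
    ⟨fun n => ⟨z n, groupAlgebra_le _ _ (hz n)⟩, C, fun n => (hzn n).trans (hC n)⟩
  have h1 := tendsto_l2Inner (ω := ω) hτ Z X
  rw [hX _ ⟨Z, hz, rfl⟩] at h1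
  have h2 : ∀ n, ⟪(Z n : K →L[ℂ] K) (vac G H), (X n : K →L[ℂ] K) (vac G H)⟫_ℂ =
      (‖vacOp G H ((X n : K →L[ℂ] K) (vac G H))‖ : ℂ) ^ 2 := fun n => by
    rw [← inner_vacOp_self, ← hzv]
  simp only [h2] at h1
  rw [tendsto_zero_iff_norm_tendsto_zero]
  have h3 := h1.norm.sqrt
  simpa using h3

theorem IsMixing.hasAsymptoticOrthogonality (hπ : IsMixing π) :
    HasAsymptoticOrthogonality hτ (bogoljubovGroupAlgebra π) := by
  -- The preceding limits hold along every ultrafilter, so any free one serves.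
  refine ⟨groupAlgebra_le _ _, hyperfilter ℕ, hyperfilter_le_cofinite, ?_⟩
  rintro x ⟨hx1, hx2⟩ y ⟨-, hy2⟩ a - b hb
  obtain ⟨X, rfl⟩ := mk_surjective hτ _ x
  obtain ⟨Y, rfl⟩ := mk_surjective hτ _ y
  obtain ⟨C, hC⟩ := X.exists_bound
  obtain ⟨D, hD⟩ := Y.exists_bound
  -- Testing b against u_k alone gives the coefficient of b `vac` at Ω ⊗ δ_k.
  have hβ : vacOp G H ((b : K →L[ℂ] K) (vac G H)) = 0 := by
    refine lp.ext (funext fun k => ?_)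
    have h1 := hb ⟨unit π k, unit_mem_crossedProduct π k⟩ (unit_mem π k)
    have h2 : ⟪unit π k (vac G H), (b : K →L[ℂ] K) (vac G H)⟫_ℂ = 0 := by
      rw [← adjoint_inner_right]
      exact h1
    rw [unit_vac, inner_deltaVec_left] at h2
    rw [vacOp_apply, Fock.vacuumProj_apply, h2, zero_smul]
    rfl
  have h := tendsto_inner_of_negligible (C := max C D) (fun n => (X n).2) (fun n => (Y n).2)
    (fun n => (hC n).trans (le_max_left _ _)) (fun n => (hD n).trans (le_max_right _ _))
    ⟨hπ.tendsto_vacOp hτ hx1, hπ.tendsto_adjoint_rightOp hτ hx2⟩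
    (hπ.tendsto_adjoint_leftOp hτ hx2) (hπ.tendsto_adjoint_rightOp hτ hy2) a.2 hβ
  rw [ofConst, ofConst, ← map_mul, ← map_mul]
  exact tendsto_nhds_unique (tendsto_l2Inner hτ _ _) h

end Ultra

end Sequences

end FreeBogoljubov

end

theorem mainTheorem2 {G : Type*} [CommGroup G] [Countable G] [Infinite G]
    {H : Type*} [NormedAddCommGroup H] [InnerProductSpace ℝ H] [CompleteSpace H]
    (π : G →* (H ≃ₗᵢ[ℝ] H)) (hπ : FreeBogoljubov.IsMixing π) :
    ∃ hτ : FreeBogoljubov.IsFaithfulNormalTrace (FreeBogoljubov.bogoljubovCrossedProduct π)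
        (FreeBogoljubov.canonicalTrace π),
      FreeBogoljubov.HasAsymptoticOrthogonality hτ (FreeBogoljubov.bogoljubovGroupAlgebra π) :=
  ⟨FreeBogoljubov.isFaithfulNormalTrace_canonicalTrace π, hπ.hasAsymptoticOrthogonality _⟩
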